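/- **Setting.** Let $\Bbbk$ be a field of characteristic $\neq 2$ and $\Gamma$ a finite abelian group. Let $(r_0,V,r_1)$ be a triple where $r_0:\Gamma\times\Gamma\to\Bbbk^\times$ is a bicharacter; $V$ is a Yetter–Drinfeld module over $\Gamma$ with a finite basis $(x_i)_{i\in I}$, coaction $x_i\mapsto g_i\otimes x_i$ and action $g\cdot x_i=r_0(g_i,g)x_i$, such that $r_0(g_i,-)=r_0(-,g_i)^{-1}$ and $r_0(g_i,g_i)=-1$; and $r_1:V\otimes V\to\Bbbk$ is a morphism of $\Gamma$-comodules. Let $H=\mathcal B(V)\#\Bbbk\Gamma$ be the bosonization of the Nichols algebra of $V$, with $\Delta(x_i)=x_i\otimes1+g_i\otimes x_i$, and let $r$ be a universal $r$-form on $H$, i.e. a convolution invertible form with $r(hh',l)=r(h,l_{(1)})r(h',l_{(2)})$, $r(h,ll')=r(h_{(1)},l')r(h_{(2)},l)$ and $r(h_{(1)},l_{(1)})h_{(2)}l_{(2)}=l_{(1)}h_{(1)}r(h_{(2)},l_{(2)})$, whose restrictions to $\Gamma\times\Gamma$ and $V\otimes V$ are $r_0$ and $r_1$. Let $\operatorname{supp}V=\langle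 g_i: i\in I\rangle$. **Zestings.** Let $\pi:H\to\Bbbk G$ be a surjective cocentral Hopf algebra map, and for $s\in G$ put $H_s=\{h:(\pi\otimes\mathrm{id})\Delta(h)=s\otimes h\}$. An *associative $G$-zesting* of $H$ consists of a subgroup $\Gamma_0$ of $G(H^{\mathrm{co}\,\pi})$, a group homomorphism $\gamma:\Gamma_0\to\operatorname{Alg}(H,\Bbbk)$ with $\langle\gamma(g),h_{(1)}\rangle h_{(2)}g=g\,h_{(1)}\langle\gamma(g),h_{(2)}\rangle$ for $g\in\Gamma_0$, $h\in H$, a normalized 2-cocycle $\lambda:G\times G\to\Gamma_0$ and a normalized 3-cochain $\omega:G^3\to\Bbbk^\times$ with $$\langle\gamma(\lambda(a,b)),\lambda(c,d)\rangle=\frac{\omega(a,b,c)\,\omega(a,bc,d)\,\omega(b,c,d)}{\omega(ab,c,d)\,\omega(a,b,cd)}\qquad(a,b,c,d\in G).\tag{A}$$ A group-like $g\in G(H)$ is *$\pi$-character-inducing*, with character $\chi_g:G\to\Bbbk^\times$, if $r(x_{(1)},g)r(g,x_{(2)})=\chi_g(s)\varepsilon(x)$ for all $s\in G$, $x\in H_s$.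 For $t:G\times G\to\Bbbk^\times$ consider the condition that every $\lambda(a,b)$ is $\pi$-character-inducing, together with $$\text{(BZ2)}\quad\frac{\omega(a,b,c)\,\omega(b,c,a)}{\omega(b,a,c)}=\frac{t(a,b)\,t(a,c)}{t(a,bc)},\qquad \text{(BZ3)}\quad\chi_{\lambda(a,b)}(c)=\frac{\omega(a,b,c)\,\omega(c,a,b)}{\omega(a,c,b)}\cdot\frac{t(a,c)\,t(b,c)}{t(ab,c)}\qquad(a,b,c\in G).$$ For $G$ abelian, a *braided $G$-zesting* of $(H,r)$ is a tuple $(\Gamma_0,\gamma,\lambda,\omega,t)$ such that $(\Gamma_0,\gamma,\lambda,\omega)$ is an associative $G$-zesting, this condition holds, $\lambda(a,b)=\lambda(b,a)$ for all $a,b\in G$, and $\langle\gamma(g),h\rangle=r^{-1}(g,h)$ for all $g\in\Gamma_0$, $h\in H$. **Theorem.** The map $H\to\Bbbk[\Gamma/\operatorname{supp}V]$, $g\mapsto[g]$, $x_i\mapsto0$, is the universal grading of $H$: it is a surjective cocentral Hopf algebra map, and every cocentral Hopf algebra map from $H$ to a group algebra factors uniquely through it by a group homomorphism. So $U(H)=\Gamma/\operatorname{supp}V$.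 Taking $G=U(H)$ and this map as $\pi$: (1) Identifying $\Gamma$ with group-like elements of $H$ and restricting $\gamma(g)$ to $\Gamma$, so that $\Phi(g)=\gamma(g)|_\Gamma$, gives a bijective correspondence between braided $U(H)$-zestings $(\Gamma_0,\gamma,\lambda,\omega,t)$ of $(H,r)$ and tuples $(\Gamma_0,\Phi,\lambda,\omega,t)$ such that (i) $\Gamma_0$ is a subgroup of $\operatorname{supp}V$ and $\Phi:\Gamma_0\to\widehat\Gamma$ is a group homomorphism with $r_0(g,g_i)^{-1}=\langle g_i,\Phi(g)\rangle$ for all $g\in\Gamma_0$, $i\in I$; (ii) $(\Phi,\lambda,\omega)$ is an associative $U(H)$-zesting, i.e. $g\cdot x_i=\langle g_i,\Phi(g)\rangle x_i$ for $g\in\Gamma_0$, $i\in I$; $\lambda:U(H)^2\to\Gamma_0$ is a normalized 2-cocycle; and $\omega:U(H)^3\to\Bbbk^\times$ is a normalized 3-cochain satisfying (A) with left side $\langle\lambda(c,d),\Phi(\lambda(a,b))\rangle$; (iii) $t:U(H)^2\to\Bbbk^\times$ satisfies (BZ2), and (BZ3) with left side $r_0(\lambda(a,b),h)\,r_0(h,\lambda(a,b))$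 for every $h\in\Gamma$ representing $c$; (iv) $\lambda$ is symmetric, and $\langle h,\Phi(g)\rangle=r_0(g,h)^{-1}$ for all $g\in\Gamma_0$, $h\in\Gamma$. (2) In the same way, the tuples satisfying (i)–(iii) alone correspond bijectively to the data $(\Gamma_0,\gamma,\lambda,\omega,t)$ that satisfy all conditions of a braided $U(H)$-zesting except possibly the symmetry of $\lambda$ and the identity $\gamma(g)=r^{-1}(g,-)$. -/

import Mathlib

open scoped TensorProduct
open WithConv

universe u v w x

namespace Zesting

noncomputable section

/-! ## The Hopf algebra `B(V) # kΓ` -/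

/-- A Yetter-Drinfeld module `V` of diagonal type over the abelian group `Γ`: `V` has a basis `(x_i)` indexed by `I`, with
coaction `x_i ↦ g_i ⊗ x_i`, where `g_i = deg i`, and action `g · x_i = χ_i(g) x_i`, where
`χ_i = char i`. -/
structure YDDatum (k : Type u) (Γ : Type v) (I : Type w) [Field k] [CommGroup Γ] where
  deg : I → Γ
  char : I → Γ →* kˣ

section Bosonization

variable {k : Type u} {Γ : Type v} {I : Type w} [Field k] [CommGroup Γ]

/-- The defining relations of `T(V) # kΓ` on the generators `g ∈ Γ` and `x_i`:
the group relations of `Γ` and `g x_i = χ_i(g) x_i g`. -/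
inductive TRel (D : YDDatum k Γ I) :
    FreeAlgebra k (Γ ⊕ I) → FreeAlgebra k (Γ ⊕ I) → Prop
  | one : TRel D (FreeAlgebra.ι k (Sum.inl 1)) 1
  | mul (a b : Γ) : TRel D (FreeAlgebra.ι k (Sum.inl (a * b)))
      (FreeAlgebra.ι k (Sum.inl a) * FreeAlgebra.ι k (Sum.inl b))
  | act (a : Γ) (i : I) :
      TRel D (FreeAlgebra.ι k (Sum.inl a) * FreeAlgebra.ι k (Sum.inr i))
        ((D.char i a : k) • (FreeAlgebra.ι k (Sum.inr i) * FreeAlgebra.ι k (Sum.inl a)))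

/-- The bosonization `T(V) # kΓ` of the tensor algebra of `V`. -/
def TBos (D : YDDatum k Γ I) : Type (max u v w) := RingQuot (TRel D)

namespace TBos

variable (D : YDDatum k Γ I)

instance : Ring (TBos D) := inferInstanceAs (Ring (RingQuot (TRel D)))
instance : Algebra k (TBos D) := inferInstanceAs (Algebra k (RingQuot (TRel D)))

/-- The quotient map from the free algebra. -/
def proj : FreeAlgebra k (Γ ⊕ I) →ₐ[k] TBos D := RingQuot.mkAlgHom k (TRel D)

/-- The element `g` of `T(V) # kΓ`. -/
def grp : Γ →* TBos D where
  toFun a := proj D (FreeAlgebra.ι k (Sum.inl a))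
  map_one' := by
    have h := RingQuot.mkAlgHom_rel k (TRel.one (D := D))
    exact h.trans (map_one _)
  map_mul' a b := by
    have h := RingQuot.mkAlgHom_rel k (TRel.mul (D := D) a b)
    exact h.trans (map_mul _ _ _)

/-- The element `x_i` of `T(V) # kΓ`. -/
def gen (i : I) : TBos D := proj D (FreeAlgebra.ι k (Sum.inr i))

theorem grp_mul_gen (a : Γ) (i : I) :
    grp D a * gen D i = (D.char i a : k) • (gen D i * grp D a) := by
  have h := RingQuot.mkAlgHom_rel k (TRel.act (D := D) a i)
  rw [map_mul, map_smul, map_mul] at h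
  exact h

variable {D}

/-- Universal property of `T(V) # kΓ`. -/
def lift {A : Type*} [Semiring A] [Algebra k A] (f : Γ →* A) (y : I → A)
    (h : ∀ a i, f a * y i = (D.char i a : k) • (y i * f a)) : TBos D →ₐ[k] A :=
  RingQuot.liftAlgHom k ⟨FreeAlgebra.lift k (Sum.elim f y), by
    intro p q hpq
    cases hpq with
    | one => simp
    | mul a b => simp
    | act a i => simpa using h a i⟩

@[simp] theorem lift_grp {A : Type*} [Semiring A] [Algebra k A] (f : Γ →* A) (y : I → A)
    (h : ∀ a i, f a * y i = (D.char i a : k) • (y i * f a)) (a : Γ) :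
    lift f y h (grp D a) = f a := by
  exact (RingQuot.liftAlgHom_mkAlgHom_apply k _ _ _).trans (FreeAlgebra.lift_ι_apply _ _)

@[simp] theorem lift_gen {A : Type*} [Semiring A] [Algebra k A] (f : Γ →* A) (y : I → A)
    (h : ∀ a i, f a * y i = (D.char i a : k) • (y i * f a)) (i : I) :
    lift f y h (gen D i) = y i := by
  exact (RingQuot.liftAlgHom_mkAlgHom_apply k _ _ _).trans (FreeAlgebra.lift_ι_apply _ _)

theorem algHom_ext {A : Type*} [Semiring A] [Algebra k A] {f f' : TBos D →ₐ[k] A}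
    (h₁ : ∀ a, f (grp D a) = f' (grp D a)) (h₂ : ∀ i, f (gen D i) = f' (gen D i)) : f = f' := by
  apply RingQuot.ringQuot_ext'
  apply FreeAlgebra.hom_ext
  funext z
  rcases z with a | i
  · exact h₁ a
  · exact h₂ i

theorem induction {p : TBos D → Prop} (hk : ∀ c : k, p (algebraMap k _ c))
    (hg : ∀ a, p (grp D a)) (hx : ∀ i, p (gen D i)) (hadd : ∀ a b, p a → p b → p (a + b))
    (hmul : ∀ a b, p a → p b → p (a * b)) (a : TBos D) : p a := by
  obtain ⟨z, rfl⟩ := RingQuot.mkAlgHom_surjective k (TRel D) a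
  induction z with
  | grade0 c =>
    have := hk c
    rwa [← (proj D).commutes c] at this
  | grade1 z =>
    rcases z with a | i
    · exact hg a
    · exact hx i
  | mul a b ha hb => rw [map_mul]; exact hmul _ _ ha hb
  | add a b ha hb => rw [map_add]; exact hadd _ _ ha hb

/-- The group homomorphism `g ↦ g ⊗ g`. -/
def grpDiag : Γ →* TBos D ⊗[k] TBos D where
  toFun a := grp D a ⊗ₜ[k] grp D a
  map_one' := by simp [Algebra.TensorProduct.one_def]
  map_mul' a b := by simp

@[simp] theorem grpDiag_apply (a : Γ) :
    grpDiag (D := D) a = grp D a ⊗ₜ[k] grp D a := rfl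

/-- The comultiplication: `Δ(g) = g ⊗ g` and `Δ(x_i) = x_i ⊗ 1 + g_i ⊗ x_i`. -/
def comulHom : TBos D →ₐ[k] TBos D ⊗[k] TBos D :=
  lift grpDiag
    (fun i => gen D i ⊗ₜ[k] 1 + grp D (D.deg i) ⊗ₜ[k] gen D i)
    (fun a i => by
      have hc : grp D a * grp D (D.deg i) = grp D (D.deg i) * grp D a := by
        rw [← map_mul, ← map_mul, mul_comm]
      simp [mul_add, add_mul, grp_mul_gen, hc, TensorProduct.smul_tmul'])

/-- The counit: `ε(g) = 1` and `ε(x_i) = 0`. -/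
def counitHom : TBos D →ₐ[k] k := lift 1 (fun _ => 0) (by simp)

instance : Bialgebra k (TBos D) :=
  Bialgebra.ofAlgHom comulHom counitHom
    (algHom_ext (by simp [comulHom]) (by
      intro i
      simp [comulHom, TensorProduct.add_tmul, TensorProduct.tmul_add, add_assoc,
        Algebra.TensorProduct.one_def]))
    (algHom_ext (by simp [comulHom, counitHom]) (by simp [comulHom, counitHom]))
    (algHom_ext (by simp [comulHom, counitHom]) (by simp [comulHom, counitHom]))

@[simp] theorem comul_grp (a : Γ) :
    Coalgebra.comul (R := k) (grp D a) = grp D a ⊗ₜ[k] grp D a :=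
  lift_grp (D := D) _ _ _ a

@[simp] theorem comul_gen (i : I) :
    Coalgebra.comul (R := k) (gen D i) = gen D i ⊗ₜ[k] 1 + grp D (D.deg i) ⊗ₜ[k] gen D i :=
  lift_gen (D := D) _ _ _ i

@[simp] theorem counit_grp (a : Γ) : Coalgebra.counit (R := k) (grp D a) = 1 :=
  lift_grp (D := D) _ _ _ a

@[simp] theorem counit_gen (i : I) : Coalgebra.counit (R := k) (gen D i) = 0 :=
  lift_gen (D := D) _ _ _ i

/-- The group homomorphism `g ↦ g⁻¹` to the opposite algebra. -/
def grpInv : Γ →* (TBos D)ᵐᵒᵖ where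
  toFun a := MulOpposite.op (grp D a⁻¹)
  map_one' := by simp
  map_mul' a b := by rw [← MulOpposite.op_mul, ← map_mul, mul_inv_rev]

@[simp] theorem grpInv_apply (a : Γ) :
    grpInv (D := D) a = MulOpposite.op (grp D a⁻¹) := rfl

theorem gen_mul_grp (a : Γ) (i : I) :
    gen D i * grp D a = ((D.char i a)⁻¹ : k) • (grp D a * gen D i) := by
  rw [grp_mul_gen, smul_smul, inv_mul_cancel₀ (Units.ne_zero _), one_smul]

/-- The antipode as an algebra map to the opposite algebra:
`S(g) = g⁻¹` and `S(x_i) = -g_i⁻¹ x_i`. -/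
def antipodeHom : TBos D →ₐ[k] (TBos D)ᵐᵒᵖ :=
  lift grpInv (fun i => MulOpposite.op (-(grp D (D.deg i)⁻¹ * gen D i)))
    (fun a i => by
      apply MulOpposite.unop_injective
      simp only [grpInv_apply, MulOpposite.unop_mul, MulOpposite.unop_op, MulOpposite.unop_smul]
      have hc : grp D a⁻¹ * grp D (D.deg i)⁻¹ = grp D (D.deg i)⁻¹ * grp D a⁻¹ := by
        rw [← map_mul, ← map_mul, mul_comm]
      rw [neg_mul, mul_neg, ← mul_assoc, hc, mul_assoc, mul_assoc, gen_mul_grp]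
      simp)

/-- The antipode as a linear map. -/
def antipodeLin : TBos D →ₗ[k] TBos D :=
  (MulOpposite.opLinearEquiv k).symm.toLinearMap ∘ₗ (antipodeHom (D := D)).toLinearMap

@[simp] theorem antipodeLin_grp (a : Γ) : antipodeLin (grp D a) = grp D a⁻¹ := by
  simp [antipodeLin, antipodeHom]

@[simp] theorem antipodeLin_gen (i : I) :
    antipodeLin (gen D i) = -(grp D (D.deg i)⁻¹ * gen D i) := by
  simp [antipodeLin, antipodeHom]

theorem antipodeLin_mul (a b : TBos D) :
    antipodeLin (a * b) = antipodeLin b * antipodeLin a := by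
  simp [antipodeLin]

theorem antipodeLin_algebraMap (c : k) :
    antipodeLin (algebraMap k (TBos D) c) = algebraMap k _ c := by
  simp [antipodeLin, MulOpposite.algebraMap_apply]

@[simp] theorem antipodeLin_one : antipodeLin (1 : TBos D) = 1 := by
  simpa using antipodeLin_algebraMap (D := D) 1

theorem antipode_left (a : TBos D) :
    LinearMap.mul' k _ ((antipodeLin (D := D)).rTensor _ (Coalgebra.comul (R := k) a)) =
      algebraMap k _ (Coalgebra.counit (R := k) a) := by
  induction a using TBos.induction with
  | hk c => simp [Algebra.TensorProduct.algebraMap_apply, antipodeLin_algebraMap]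
  | hg a => simp [← map_mul]
  | hx i => simp [antipodeLin_gen]
  | hadd a b ha hb => simp [ha, hb]
  | hmul a b ha hb =>
    have key : ∀ z y : TBos D ⊗[k] TBos D, ∀ c : k,
        LinearMap.mul' k _ ((antipodeLin (D := D)).rTensor _ z) = algebraMap k _ c →
        LinearMap.mul' k _ ((antipodeLin (D := D)).rTensor _ (z * y)) =
          c • LinearMap.mul' k _ ((antipodeLin (D := D)).rTensor _ y) := by
      intro z y c hz
      induction y using TensorProduct.induction_on with
      | zero => simp
      | add y y' h h' => simp only [mul_add, map_add, h, h', smul_add]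
      | tmul p q =>
        have : ∀ z : TBos D ⊗[k] TBos D,
            LinearMap.mul' k _ ((antipodeLin (D := D)).rTensor _ (z * p ⊗ₜ[k] q)) =
            antipodeLin p * LinearMap.mul' k _ ((antipodeLin (D := D)).rTensor _ z) * q := by
          intro z
          induction z using TensorProduct.induction_on with
          | zero => simp
          | add z z' h h' => simp only [add_mul, mul_add, map_add, h, h']
          | tmul r s => simp [antipodeLin_mul, mul_assoc]
        rw [this, hz, ← Algebra.commutes, mul_assoc, ← Algebra.smul_def]
        simp
    rw [Bialgebra.comul_mul, key _ _ _ ha, hb, Bialgebra.counit_mul, map_mul, Algebra.smul_def]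

theorem antipode_right (a : TBos D) :
    LinearMap.mul' k _ ((antipodeLin (D := D)).lTensor _ (Coalgebra.comul (R := k) a)) =
      algebraMap k _ (Coalgebra.counit (R := k) a) := by
  induction a using TBos.induction with
  | hk c =>
    simp [Algebra.TensorProduct.algebraMap_apply]
  | hg a => simp [← map_mul]
  | hx i =>
    simp [antipodeLin_gen, ← mul_assoc, ← map_mul]
  | hadd a b ha hb => simp [ha, hb]
  | hmul a b ha hb =>
    have key : ∀ z y : TBos D ⊗[k] TBos D, ∀ c : k,
        LinearMap.mul' k _ ((antipodeLin (D := D)).lTensor _ y) = algebraMap k _ c →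
        LinearMap.mul' k _ ((antipodeLin (D := D)).lTensor _ (z * y)) =
          c • LinearMap.mul' k _ ((antipodeLin (D := D)).lTensor _ z) := by
      intro z y c hy
      induction z using TensorProduct.induction_on with
      | zero => simp
      | add y y' h h' => simp only [add_mul, map_add, h, h', smul_add]
      | tmul p q =>
        have : ∀ y : TBos D ⊗[k] TBos D,
            LinearMap.mul' k _ ((antipodeLin (D := D)).lTensor _ (p ⊗ₜ[k] q * y)) =
            p * LinearMap.mul' k _ ((antipodeLin (D := D)).lTensor _ y) * antipodeLin q := by
          intro y
          induction y using TensorProduct.induction_on with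
          | zero => simp
          | add z z' h h' => simp only [add_mul, mul_add, map_add, h, h']
          | tmul r s => simp [antipodeLin_mul, mul_assoc]
        rw [this, hy, ← Algebra.commutes, mul_assoc, ← Algebra.smul_def]
        simp
    rw [Bialgebra.comul_mul, key _ _ _ hb, ha, Bialgebra.counit_mul, map_mul, Algebra.smul_def,
      Algebra.commutes]

instance : HopfAlgebra k (TBos D) where
  antipode := antipodeLin
  mul_antipode_rTensor_comul := LinearMap.ext antipode_left
  mul_antipode_lTensor_comul := LinearMap.ext antipode_right

variable (D)

/-- The subspace `⊕_{n ≥ 2} T^n(V) # kΓ`, spanned by the elements `x_{i_1} ⋯ x_{i_n} g`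
with `n ≥ 2`. -/
def degGeTwo : Submodule k (TBos D) :=
  Submodule.span k {a | ∃ (l : List I) (g : Γ), 2 ≤ l.length ∧
    a = (l.map (gen D)).prod * grp D g}

/-- The Hopf ideals of `T(V) # kΓ` contained in `⊕_{n ≥ 2} T^n(V) # kΓ`. -/
def hopfIdeals : Set (Ideal (TBos D)) :=
  {J | J.IsTwoSided ∧ J.IsHopfIdeal k ∧ J.restrictScalars k ≤ degGeTwo D}

/-- The defining ideal `I(V) # kΓ` of `B(V) # kΓ`: the largest Hopf ideal of `T(V) # kΓ`
contained in `⊕_{n ≥ 2} T^n(V) # kΓ`. -/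
def nicholsIdeal : Ideal (TBos D) := sSup (hopfIdeals D)

theorem nicholsIdeal_induction {p : TBos D → Prop}
    (hmem : ∀ J ∈ hopfIdeals D, ∀ a ∈ J, p a) (hzero : p 0)
    (hadd : ∀ a b, p a → p b → p (a + b)) {a : TBos D} (ha : a ∈ nicholsIdeal D) : p a := by
  rw [nicholsIdeal, sSup_eq_iSup'] at ha
  exact Submodule.iSup_induction _ (motive := p) ha (fun J a h => hmem J.1 J.2 a h) hzero hadd

theorem le_nicholsIdeal {J : Ideal (TBos D)} (hJ : J ∈ hopfIdeals D) : J ≤ nicholsIdeal D :=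
  le_sSup hJ

instance : (nicholsIdeal D).IsTwoSided where
  mul_mem_of_left b ha := by
    refine nicholsIdeal_induction D (p := fun a => a * b ∈ nicholsIdeal D) ?_ ?_ ?_ ha
    · intro J hJ a ha
      have := hJ.1
      exact le_nicholsIdeal D hJ (Ideal.mul_mem_right b J ha)
    · simp
    · intro a c h h'
      rw [add_mul]
      exact add_mem h h'

instance : (nicholsIdeal D).IsHopfIdeal k where
  counit_eq_zero a ha := by
    refine nicholsIdeal_induction D
      (p := fun a => Coalgebra.counit (R := k) a = 0) ?_ ?_ ?_ ha
    · intro J hJ a ha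
      exact hJ.2.1.counit_eq_zero ha
    · simp
    · intro a c h h'
      rw [map_add, h, h', add_zero]
  map_mkQ_comul_eq_zero a ha := by
    refine nicholsIdeal_induction D
      (p := fun a => TensorProduct.map ((nicholsIdeal D).restrictScalars k).mkQ
        ((nicholsIdeal D).restrictScalars k).mkQ (Coalgebra.comul (R := k) a) = 0) ?_ ?_ ?_ ha
    · intro J hJ a ha
      have h := hJ.2.1.map_mkQ_comul_eq_zero ha
      have hle : J.restrictScalars k ≤ (nicholsIdeal D).restrictScalars k := le_nicholsIdeal D hJ
      have hf : Submodule.factor hle ∘ₗ (J.restrictScalars k).mkQ =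
          ((nicholsIdeal D).restrictScalars k).mkQ := Submodule.factor_comp_mk hle
      rw [← hf, TensorProduct.map_comp, LinearMap.comp_apply, h, map_zero]
    · simp
    · intro a c h h'
      rw [map_add, map_add, h, h', add_zero]
  antipode_mem a ha := by
    refine nicholsIdeal_induction D
      (p := fun a => HopfAlgebra.antipode k a ∈ nicholsIdeal D) ?_ ?_ ?_ ha
    · intro J hJ a ha
      exact le_nicholsIdeal D hJ (hJ.2.1.antipode_mem ha)
    · simp
    · intro a c h h'
      rw [map_add]
      exact add_mem h h'

theorem nicholsIdeal_le : (nicholsIdeal D).restrictScalars k ≤ degGeTwo D := by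
  intro a ha
  refine nicholsIdeal_induction D (p := fun a => a ∈ degGeTwo D) ?_ ?_ ?_ ha
  · intro J hJ a ha
    exact hJ.2.2 ha
  · exact zero_mem _
  · intro a c h h'
    exact add_mem h h'

end TBos

/-- The Hopf algebra `B(V) # kΓ`, where `B(V)` is the Nichols algebra of `V`. -/
abbrev Bos (D : YDDatum k Γ I) : Type (max u v w) := TBos D ⧸ TBos.nicholsIdeal D

namespace Bos

variable (D : YDDatum k Γ I)

/-- The element `x_i` of `B(V) # kΓ`. -/
def gen (i : I) : Bos D := Ideal.Quotient.mk _ (TBos.gen D i)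

/-- The group-like elements `g ∈ Γ` of `B(V) # kΓ`. -/
def grp : Γ →* GroupLike k (Bos D) where
  toFun a := ⟨Ideal.Quotient.mk _ (TBos.grp D a), by
    constructor
    · rw [Bialgebra.Quotient.counit_mk, TBos.counit_grp]
    · rw [Bialgebra.Quotient.comul_mk, TBos.comul_grp]
      rfl⟩
  map_one' := by ext; simp
  map_mul' a b := by ext; simp

/-- The support of `V`: the subgroup of `Γ` generated by the `g_i`. -/
def supp : Subgroup Γ := Subgroup.closure (Set.range D.deg)

/-- The algebra map `T(V) # kΓ → k[Γ / supp V]`, `g ↦ [g]`, `x_i ↦ 0`. -/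
def tgrading : TBos D →ₐ[k] MonoidAlgebra k (Γ ⧸ supp D) :=
  TBos.lift ((MonoidAlgebra.of k (Γ ⧸ supp D)).comp (QuotientGroup.mk' (supp D)))
    (fun _ => 0) (by simp)

theorem tgrading_eq_zero {a : TBos D} (ha : a ∈ TBos.nicholsIdeal D) : tgrading D a = 0 := by
  have h : TBos.degGeTwo D ≤ LinearMap.ker (tgrading D).toLinearMap := by
    refine Submodule.span_le.2 ?_
    rintro _ ⟨l, g, hl, rfl⟩
    cases l with
    | nil => simp at hl
    | cons i l => simp [tgrading]
  exact h (TBos.nicholsIdeal_le D ha)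

/-- The algebra map `B(V) # kΓ → k[Γ / supp V]`, `g ↦ [g]`, `x_i ↦ 0`. -/
def gradingAlgHom : Bos D →ₐ[k] MonoidAlgebra k (Γ ⧸ supp D) :=
  Ideal.Quotient.liftₐ _ (tgrading D) (fun _ ha => tgrading_eq_zero D ha)

theorem gradingAlgHom_mk (a : TBos D) :
    gradingAlgHom D (Ideal.Quotient.mk _ a) = tgrading D a := rfl

/-- The Hopf algebra map `B(V) # kΓ → k[Γ / supp V]`, `g ↦ [g]`, `x_i ↦ 0`. -/
def grading : Bos D →ₐc[k] MonoidAlgebra k (Γ ⧸ supp D) :=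
  BialgHom.ofAlgHom (gradingAlgHom D)
    (Ideal.Quotient.algHom_ext k (TBos.algHom_ext
      (by intro a; simp [gradingAlgHom_mk, tgrading])
      (by intro i; simp [gradingAlgHom_mk, tgrading])))
    (Ideal.Quotient.algHom_ext k (TBos.algHom_ext
      (by intro a; simp [gradingAlgHom_mk, tgrading])
      (by intro i; simp [gradingAlgHom_mk, tgrading])))

end Bos

end Bosonization

/-! ## Zestings of Hopf algebras -/

section Hopf

variable {k : Type u} {H : Type v} {G : Type w} [Field k] [Ring H] [HopfAlgebra k H] [Group G]

/-- A Hopf algebra map `π : H → kG` is cocentral if `(id ⊗ π) Δ = (id ⊗ π) Δ^op`. -/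
def IsCocentral (π : H →ₐc[k] MonoidAlgebra k G) : Prop :=
  ∀ h : H, TensorProduct.map LinearMap.id (π : H →ₗ[k] MonoidAlgebra k G)
      (Coalgebra.comul (R := k) h) =
    TensorProduct.map LinearMap.id (π : H →ₗ[k] MonoidAlgebra k G)
      (TensorProduct.comm k H H (Coalgebra.comul (R := k) h))

/-- `π : H → kG` exhibits `G` as the universal grading group `U(H)`: it is a cocentral Hopf
epimorphism, and every cocentral Hopf map from `H` to a group algebra factors uniquely through
it by a group homomorphism. -/
structure IsUniversalGrading (π : H →ₐc[k] MonoidAlgebra k G) : Prop where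
  surjective : Function.Surjective π
  cocentral : IsCocentral π
  universal : ∀ (G' : Type x) [Group G'] (ρ : H →ₐc[k] MonoidAlgebra k G'), IsCocentral ρ →
    ∃! φ : G →* G', (MonoidAlgebra.mapDomainBialgHom k φ).comp π = ρ

/-- The coinvariants `H^{co π} = {h | (id ⊗ π) Δ(h) = h ⊗ 1}`. -/
def coinvariants (π : H →ₐc[k] MonoidAlgebra k G) : Set H :=
  {h | TensorProduct.map LinearMap.id (π : H →ₗ[k] MonoidAlgebra k G)
    (Coalgebra.comul (R := k) h) = h ⊗ₜ[k] 1}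

/-- The homogeneous component `H_s = {h | (π ⊗ id) Δ(h) = s ⊗ h}`. -/
def component (π : H →ₐc[k] MonoidAlgebra k G) (s : G) : Set H :=
  {h | TensorProduct.map (π : H →ₗ[k] MonoidAlgebra k G) LinearMap.id
    (Coalgebra.comul (R := k) h) = MonoidAlgebra.of k G s ⊗ₜ[k] h}

/-- A convolution invertible linear form on `H ⊗ H`, as a bilinear form on `H`. -/
def form (r : (WithConv (H ⊗[k] H →ₗ[k] k))ˣ) : H →ₗ[k] H →ₗ[k] k :=
  TensorProduct.curry r.val.ofConv

/-- `r` is a universal `r`-form (a coquasitriangular structure) on `H`. -/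
structure IsUniversalRForm (r : (WithConv (H ⊗[k] H →ₗ[k] k))ˣ) : Prop where
  /-- `r(h h', l) = r(h, l₁) r(h', l₂)` -/
  mul_left : ∀ h h' l : H, form r (h * h') l =
    LinearMap.mul' k k (TensorProduct.map (form r h) (form r h') (Coalgebra.comul (R := k) l))
  /-- `r(h, l l') = r(h₁, l') r(h₂, l)` -/
  mul_right : ∀ h l l' : H, form r h (l * l') =
    LinearMap.mul' k k (TensorProduct.map ((form r).flip l') ((form r).flip l)
      (Coalgebra.comul (R := k) h))
  /-- `r(h₁, l₁) h₂ l₂ = l₁ h₁ r(h₂, l₂)` -/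
  comm : ∀ z : H ⊗[k] H,
    TensorProduct.lid k H (TensorProduct.map r.val.ofConv (LinearMap.mul' k H)
      (Coalgebra.comul (R := k) z)) =
    TensorProduct.rid k H (TensorProduct.map
      (LinearMap.mul' k H ∘ₗ (TensorProduct.comm k H H).toLinearMap) r.val.ofConv
      (Coalgebra.comul (R := k) z))

/-- `f : G × G → A` is a normalized 2-cocycle (with trivial action). -/
structure IsNormalizedTwoCocycle {A : Type*} [Group A] (f : G → G → A) : Prop where
  one_left : ∀ a, f 1 a = 1
  one_right : ∀ a, f a 1 = 1
  cocycle : ∀ a b c, f a b * f (a * b) c = f b c * f a (b * c)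

/-- `f : G × G × G → A` is a normalized 3-cochain. -/
structure IsNormalizedThreeCochain {A : Type*} [Group A] (f : G → G → G → A) : Prop where
  one_left : ∀ a b, f 1 a b = 1
  one_mid : ∀ a b, f a 1 b = 1
  one_right : ∀ a b, f a b 1 = 1

variable (k H G) in
/-- The data `(Γ₀, γ, λ, ω, t)` underlying a braided `G`-zesting of `H`. The monoid structure on
`WithConv (H →ₐ[k] k)` is the convolution product on `Alg(H, k)`. -/
structure ZestingData where
  Γ₀ : Subgroup (GroupLike k H)
  γ : Γ₀ →* WithConv (H →ₐ[k] k)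
  lam : G → G → Γ₀
  om : G → G → G → kˣ
  t : G → G → kˣ

/-- `(γ, λ, ω)` is an associative `G`-zesting datum for `H` (with respect to `π`). -/
structure ZestingData.IsAssociative (Z : ZestingData k H G) (π : H →ₐc[k] MonoidAlgebra k G) :
    Prop where
  mem_coinvariants : ∀ g ∈ Z.Γ₀, (g : H) ∈ coinvariants π
  /-- `⟨γ(g), h₁⟩ h₂ g = g h₁ ⟨γ(g), h₂⟩` -/
  central : ∀ (g : Z.Γ₀) (h : H),
    TensorProduct.lid k H (TensorProduct.map (Z.γ g).ofConv.toLinearMap LinearMap.id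
      (Coalgebra.comul (R := k) h)) * (g : GroupLike k H).val =
    (g : GroupLike k H).val * TensorProduct.rid k H (TensorProduct.map LinearMap.id
      (Z.γ g).ofConv.toLinearMap (Coalgebra.comul (R := k) h))
  lam_cocycle : IsNormalizedTwoCocycle Z.lam
  om_normalized : IsNormalizedThreeCochain Z.om
  compat : ∀ a b c d : G, (Z.γ (Z.lam a b)).ofConv (Z.lam c d : GroupLike k H).val =
    ((Z.om a b c * Z.om a (b * c) d * Z.om b c d / (Z.om (a * b) c d * Z.om a b (c * d)) : kˣ) : k)

/-- The group-like element `g` is `π`-character-inducing, with induced character `c`: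
`r(x₁, g) r(g, x₂) = c(s) ε(x)` for all `s ∈ G` and `x ∈ H_s`. -/
def InducesCharacter (r : (WithConv (H ⊗[k] H →ₗ[k] k))ˣ) (π : H →ₐc[k] MonoidAlgebra k G)
    (g : GroupLike k H) (c : G →* kˣ) : Prop :=
  ∀ (s : G), ∀ x ∈ component π s,
    LinearMap.mul' k k (TensorProduct.map ((form r).flip g.val) (form r g.val)
      (Coalgebra.comul (R := k) x)) = (c s : k) * Coalgebra.counit (R := k) x

/-- The braided zesting equations: every `λ(g₁, g₂)` is `π`-character-inducing, and the two
equations relating `ω`, `t` and the induced characters hold. -/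
structure ZestingData.SatisfiesBZ (Z : ZestingData k H G)
    (r : (WithConv (H ⊗[k] H →ₗ[k] k))ˣ) (π : H →ₐc[k] MonoidAlgebra k G) : Prop where
  bz2 : ∀ a b c : G, Z.om a b c * Z.om b c a / Z.om b a c = Z.t a b * Z.t a c / Z.t a (b * c)
  bz3 : ∀ a b : G, ∃ χ : G →* kˣ, InducesCharacter r π (Z.lam a b) χ ∧
    ∀ c : G, χ c = Z.om a b c * Z.om c a b / Z.om a c b * (Z.t a c * Z.t b c / Z.t (a * b) c)

/-- `(Γ₀, γ, λ, ω, t)` is a braided `G`-zesting of the coquasitriangular Hopf algebra `(H, r)`. -/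
structure ZestingData.IsBraided (Z : ZestingData k H G)
    (r : (WithConv (H ⊗[k] H →ₗ[k] k))ˣ) (π : H →ₐc[k] MonoidAlgebra k G) : Prop where
  comm : ∀ a b : G, a * b = b * a
  isAssociative : Z.IsAssociative π
  /-- `γ` is the restriction of `f'`, where `⟨f'(l), h⟩ = r⁻¹(l, h)`. -/
  gamma_eq : ∀ (g : Z.Γ₀) (h : H), (Z.γ g).ofConv h = form r⁻¹ (g : GroupLike k H).val h
  lam_symm : ∀ a b : G, Z.lam a b = Z.lam b a
  satisfiesBZ : Z.SatisfiesBZ r π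

end Hopf

/-! ## Coquasitriangular pointed Hopf algebras attached to triples -/

section Triple

variable {k : Type u} {Γ : Type v} {I : Type w} [Field k] [CommGroup Γ]

variable (k Γ I) in
/-- A triple `(r₀, V, r₁)`: `r₀` is a bicharacter on `Γ`; `V` has a basis `(x_i)` with coaction
given by `g_i = deg i`, such that `r₀(g_i, -) = r₀(-, g_i)⁻¹`, and action given by
`χ_i = r₀(g_i, -)`, such that `χ_i(g_i) = -1`; and `r₁ : V ⊗ V → k` is a morphism of
`Γ`-comodules, given by its matrix. -/
structure BraidingTriple where
  r₀ : Γ →* (Γ →* kˣ)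
  deg : I → Γ
  symm : ∀ i g, r₀ (deg i) g = (r₀ g (deg i))⁻¹
  minus : ∀ i, r₀ (deg i) (deg i) = -1
  r₁ : I → I → k
  r₁_comodule : ∀ i j, r₁ i j ≠ 0 → deg i * deg j = 1

namespace BraidingTriple

/-- The Yetter-Drinfeld module `V` of the triple. -/
def yd (P : BraidingTriple k Γ I) : YDDatum k Γ I where
  deg := P.deg
  char i := P.r₀ (P.deg i)

/-- The Hopf algebra `H = B(V) # kΓ`. -/
abbrev H (P : BraidingTriple k Γ I) : Type (max u v w) := Bos P.yd

/-- The universal grading group `U(H) = Γ / supp V`. -/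
abbrev U (P : BraidingTriple k Γ I) : Type v := Γ ⧸ Bos.supp P.yd

/-- The map `H → k U(H)`. -/
abbrev π (P : BraidingTriple k Γ I) : P.H →ₐc[k] MonoidAlgebra k P.U := Bos.grading P.yd

/-- `r` is a universal `r`-form on `H` whose restrictions to `Γ × Γ` and `V ⊗ V` are `r₀`
and `r₁`. -/
structure IsRForm (P : BraidingTriple k Γ I) (r : (WithConv (P.H ⊗[k] P.H →ₗ[k] k))ˣ) :
    Prop where
  isUniversalRForm : IsUniversalRForm r
  grp : ∀ a b : Γ, form r (Bos.grp P.yd a).val (Bos.grp P.yd b).val = (P.r₀ a b : k)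
  gen : ∀ i j : I, form r (Bos.gen P.yd i) (Bos.gen P.yd j) = P.r₁ i j

end BraidingTriple

variable (k Γ) in
/-- The data `(Γ₀, Φ, λ, ω, t)`. -/
structure FiveTuple (U : Type w) where
  Γ₀ : Subgroup Γ
  Φ : Γ₀ →* (Γ →* kˣ)
  lam : U → U → Γ₀
  om : U → U → U → kˣ
  t : U → U → kˣ

namespace FiveTuple

/-- `Γ₀ ≤ supp V` and `r₀(g, g_i)⁻¹ = ⟨g_i, Φ(g)⟩`; `(Φ, λ, ω)` is an associative zesting; and
`t` satisfies the two braided zesting equations. -/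
structure IsAdmissible (P : BraidingTriple k Γ I) (T : FiveTuple k Γ P.U) : Prop where
  le_supp : T.Γ₀ ≤ Bos.supp P.yd
  phi_deg : ∀ (g : T.Γ₀) (i : I), (P.r₀ g (P.deg i))⁻¹ = T.Φ g (P.deg i)
  /-- `g · x_i = ⟨g_i, Φ(g)⟩ x_i` -/
  phi_act : ∀ (g : T.Γ₀) (i : I), P.yd.char i g = T.Φ g (P.deg i)
  lam_cocycle : IsNormalizedTwoCocycle T.lam
  om_normalized : IsNormalizedThreeCochain T.om
  compat : ∀ a b c d : P.U, T.Φ (T.lam a b) (T.lam c d) =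
    T.om a b c * T.om a (b * c) d * T.om b c d / (T.om (a * b) c d * T.om a b (c * d))
  bz2 : ∀ a b c : P.U, T.om a b c * T.om b c a / T.om b a c = T.t a b * T.t a c / T.t a (b * c)
  bz3 : ∀ (a b : P.U) (h : Γ), P.r₀ (T.lam a b) h * P.r₀ h (T.lam a b) =
    T.om a b h * T.om h a b / T.om a h b * (T.t a h * T.t b h / T.t (a * b) h)

/-- The conditions on a tuple expressing that `λ` is symmetric and that `Φ` is the restriction of
`f'`, that is, `⟨h, Φ(g)⟩ = r₀(g, h)⁻¹` for all `h ∈ Γ`. -/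
structure IsCompatible (P : BraidingTriple k Γ I) (T : FiveTuple k Γ P.U) : Prop where
  lam_symm : ∀ a b : P.U, T.lam a b = T.lam b a
  phi_eq : ∀ (g : T.Γ₀) (h : Γ), T.Φ g h = (P.r₀ g h)⁻¹

/-- The zesting data `Z` and the tuple `T` correspond to each other: `Γ₀`, `λ`, `ω`, `t` agree
(identifying `g ∈ Γ` with the group-like element `g` of `H`), and `Φ(g)` is the restriction of
`γ(g)` to `Γ`. -/
structure Corresponds (P : BraidingTriple k Γ I) (Z : ZestingData k P.H P.U)
    (T : FiveTuple k Γ P.U) : Prop where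
  mem_iff : ∀ g : Γ, Bos.grp P.yd g ∈ Z.Γ₀ ↔ g ∈ T.Γ₀
  gamma : ∀ (g : T.Γ₀) (h : Γ),
    (Z.γ ⟨Bos.grp P.yd g, (mem_iff g).2 g.2⟩).ofConv (Bos.grp P.yd h).val = (T.Φ g h : k)
  lam : ∀ a b : P.U, (Z.lam a b : GroupLike k P.H) = Bos.grp P.yd (T.lam a b)
  om : Z.om = T.om
  t : Z.t = T.t

end FiveTuple

end Triple

end

end Zesting

namespace Zesting

noncomputable section

/-! ### Generators, small quotients and the degree filtration of `B(V) # kΓ`. -/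

namespace Bos

variable {k : Type u} {Γ : Type v} {I : Type w} [Field k] [CommGroup Γ] (D : YDDatum k Γ I)

/-! Every piece of a zesting of `H = B(V) # kΓ` is visible on `Γ`, so the correspondence is
restriction to `Γ` and each zesting axiom becomes an identity on `Γ`. All that is used of the
Nichols algebra is that its relations have degree at least two in the `x_i`.

Three facts carry this. First, the group-likes of `H` are exactly `Γ` (`grp_injective`,
`grp_surjective`). A filtration by degree in the `x_i` has degree-zero part `kΓ`, and a group-like
outside `kΓ` would contradict how the comultiplication respects the filtration. Hence subgroups of
`G(H)` and cochains valued in them are the same as for `Γ`.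

Second, every algebra map `H → k` kills the `x_i`: `g_i x_i = -x_i g_i` and `2 ≠ 0`. So `Alg(H, k)`
is the character group of `Γ` (`charEquiv`), and `γ` and `Φ` carry the same information.

Third, for `g` in `Γ` both `r(-, g)` and `r(g, -)` are algebra maps to `k`, so they and their
convolution products are known from `r₀`. This settles which characters `g` induces
(`inducesCharacter_iff`, `exists_inducesCharacter`) and when `γ(g) = r⁻¹(g, -)` (`eq_form_inv_iff`).
The centrality axiom compares two algebra endomorphisms and can be tested on generators
(`central_iff`).

For the universal grading, cocentrality of a map to a group algebra, tested on `x_i` with two linear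
functionals, forces `g_i ↦ 1` and `x_i ↦ 0`. -/

@[simp] theorem comul_grp (g : Γ) :
    Coalgebra.comul (R := k) (grp D g).val = (grp D g).val ⊗ₜ[k] (grp D g).val :=
  (grp D g).2.comul_eq_tmul_self

@[simp] theorem counit_grp (g : Γ) : Coalgebra.counit (R := k) (grp D g).val = 1 :=
  (grp D g).2.counit_eq_one

@[simp] theorem comul_gen (i : I) :
    Coalgebra.comul (R := k) (gen D i) =
      gen D i ⊗ₜ[k] 1 + (grp D (D.deg i)).val ⊗ₜ[k] gen D i := by
  rw [gen, Bialgebra.Quotient.comul_mk, TBos.comul_gen, map_add]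
  rfl

@[simp] theorem counit_gen (i : I) : Coalgebra.counit (R := k) (gen D i) = 0 := by
  rw [gen, Bialgebra.Quotient.counit_mk, TBos.counit_gen]

theorem grp_mul_gen (g : Γ) (i : I) :
    (grp D g).val * gen D i = (D.char i g : k) • (gen D i * (grp D g).val) :=
  congrArg (Ideal.Quotient.mkₐ k (TBos.nicholsIdeal D)) (TBos.grp_mul_gen D g i)

variable {D}

theorem algHom_ext {A : Type*} [Semiring A] [Algebra k A] {f f' : Bos D →ₐ[k] A}
    (h₁ : ∀ g, f (grp D g).val = f' (grp D g).val) (h₂ : ∀ i, f (gen D i) = f' (gen D i)) :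
    f = f' :=
  Ideal.Quotient.algHom_ext k (TBos.algHom_ext h₁ h₂)

theorem induction {p : Bos D → Prop} (hk : ∀ c : k, p (algebraMap k _ c))
    (hg : ∀ g, p (grp D g).val) (hx : ∀ i, p (gen D i)) (hadd : ∀ a b, p a → p b → p (a + b))
    (hmul : ∀ a b, p a → p b → p (a * b)) (a : Bos D) : p a := by
  obtain ⟨a, rfl⟩ := Ideal.Quotient.mk_surjective a
  induction a using TBos.induction with
  | hk c => exact hk c
  | hg g => exact hg g
  | hx i => exact hx i
  | hadd a b ha hb => rw [map_add]; exact hadd _ _ ha hb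
  | hmul a b ha hb => rw [map_mul]; exact hmul _ _ ha hb

/-- Algebra maps out of `B(V) # kΓ` for which all products of two `x_i` vanish. -/
def lift {A : Type*} [Semiring A] [Algebra k A] (f : Γ →* A) (y : I → A)
    (h : ∀ a i, f a * y i = (D.char i a : k) • (y i * f a)) (hy : ∀ i j, y i * y j = 0) :
    Bos D →ₐ[k] A :=
  Ideal.Quotient.liftₐ _ (TBos.lift f y h) (fun a ha => by
    have hle : TBos.degGeTwo D ≤ LinearMap.ker (TBos.lift f y h).toLinearMap := by
      refine Submodule.span_le.2 ?_
      rintro _ ⟨l, g, hl, rfl⟩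
      -- A word of length at least two maps to a product containing `y i * y j = 0`.
      match l, hl with
      | i :: j :: l, _ => simp [← mul_assoc, hy]
    exact hle (TBos.nicholsIdeal_le D ha))

@[simp] theorem lift_grp {A : Type*} [Semiring A] [Algebra k A] (f : Γ →* A) (y : I → A)
    (h : ∀ a i, f a * y i = (D.char i a : k) • (y i * f a)) (hy : ∀ i j, y i * y j = 0) (g : Γ) :
    lift f y h hy (grp D g).val = f g :=
  TBos.lift_grp f y h g

@[simp] theorem lift_gen {A : Type*} [Semiring A] [Algebra k A] (f : Γ →* A) (y : I → A)
    (h : ∀ a i, f a * y i = (D.char i a : k) • (y i * f a)) (hy : ∀ i j, y i * y j = 0) (i : I) :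
    lift f y h hy (gen D i) = y i :=
  TBos.lift_gen f y h i

variable (D)

/-- The algebra map `B(V) # kΓ → kΓ`, `g ↦ g`, `x_i ↦ 0`. -/
def toGroupAlgebra : Bos D →ₐ[k] MonoidAlgebra k Γ :=
  lift (MonoidAlgebra.of k Γ) (fun _ => 0) (by simp) (by simp)

@[simp] theorem toGroupAlgebra_grp (g : Γ) :
    toGroupAlgebra D (grp D g).val = MonoidAlgebra.of k Γ g := lift_grp _ _ _ _ g

@[simp] theorem toGroupAlgebra_gen (i : I) : toGroupAlgebra D (gen D i) = 0 := lift_gen _ _ _ _ i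

/-- The projection to `kΓ` sends distinct elements of `Γ` to distinct basis vectors. -/
theorem grp_injective : Function.Injective (grp D) := fun g h e =>
  MonoidAlgebra.of_injective (R := k) (by
    rw [← toGroupAlgebra_grp D g, ← toGroupAlgebra_grp D h, e])

/-- The representation of `B(V) # kΓ` by upper triangular matrices with
`g ↦ diag(χ_i(g), 1)`, `x_i ↦ E₁₂` and `x_j ↦ 0` for `j ≠ i`. -/
def triangular [DecidableEq I] (i : I) : Bos D →ₐ[k] Matrix (Fin 2) (Fin 2) k :=
  lift
    { toFun := fun g => !![(D.char i g : k), 0; 0, 1]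
      map_one' := by simp [Matrix.one_fin_two]
      map_mul' := by simp }
    (fun j => if j = i then !![0, 1; 0, 0] else 0)
    (by
      intro a j
      by_cases h : j = i
      · subst h
        simp
      · simp [h])
    (by
      intro j l
      by_cases h : j = i <;> by_cases h' : l = i <;> simp [h, h']
      ext a b; fin_cases a <;> fin_cases b <;> rfl)

open Classical in
/-- A linear form on `B(V) # kΓ` sending `x_i g` to `1` and vanishing on `Γ`. -/
def coeffGen (i : I) : Bos D →ₗ[k] k :=
  Matrix.entryLinearMap k k 0 1 ∘ₗ (triangular D i).toLinearMap

@[simp] theorem coeffGen_grp (i : I) (g : Γ) : coeffGen D i (grp D g).val = 0 := by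
  simp [coeffGen, triangular]

@[simp] theorem coeffGen_gen_mul_grp (i : I) (g : Γ) :
    coeffGen D i (gen D i * (grp D g).val) = 1 := by
  simp [coeffGen, triangular]

@[simp] theorem coeffGen_gen (i : I) : coeffGen D i (gen D i) = 1 := by
  simp [coeffGen, triangular]

@[simp] theorem coeffGen_one (i : I) : coeffGen D i 1 = 0 := by
  simpa using coeffGen_grp D i 1

/-- Needed to cancel `x_i g` when comparing scalars in `central_iff`. -/
theorem gen_mul_grp_ne_zero (i : I) (g : Γ) : gen D i * (grp D g).val ≠ 0 := fun h => by
  simpa [h] using coeffGen_gen_mul_grp D i g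

/-! ### Group-like elements -/

/-- The span of `Γ`. -/
def grpSpan : Submodule k (Bos D) := Submodule.span k (Set.range fun g => (grp D g).val)

/-- The span of the elements `g` and `x_i g`. -/
def genSpan : Submodule k (Bos D) :=
  grpSpan D ⊔ Submodule.span k (Set.range fun p : I × Γ => gen D p.1 * (grp D p.2).val)

/-- The filtration of `B(V) # kΓ` by the degree in the `x_i`. -/
def filtration (n : ℕ) : Submodule k (Bos D) := grpSpan D * genSpan D ^ n

theorem grp_mem_grpSpan (g : Γ) : (grp D g).val ∈ grpSpan D := Submodule.subset_span ⟨g, rfl⟩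

theorem gen_mul_grp_mem_genSpan (i : I) (g : Γ) : gen D i * (grp D g).val ∈ genSpan D :=
  Submodule.mem_sup_right (Submodule.subset_span ⟨(i, g), rfl⟩)

theorem gen_mem_genSpan (i : I) : gen D i ∈ genSpan D := by
  simpa using gen_mul_grp_mem_genSpan D i 1

theorem grpSpan_le_genSpan : grpSpan D ≤ genSpan D := le_sup_left

theorem one_mem_grpSpan : (1 : Bos D) ∈ grpSpan D := by
  simpa using grp_mem_grpSpan D 1

theorem grpSpan_mul_self : grpSpan D * grpSpan D ≤ grpSpan D := by
  rw [grpSpan, Submodule.span_mul_span, Submodule.span_le]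
  rintro _ ⟨_, ⟨g, rfl⟩, _, ⟨h, rfl⟩, rfl⟩
  exact Submodule.subset_span ⟨g * h, by simp⟩

theorem genSpan_mul_grpSpan : genSpan D * grpSpan D ≤ genSpan D := by
  rw [genSpan, Submodule.sup_mul]
  refine sup_le_sup (grpSpan_mul_self D) ?_
  rw [grpSpan, Submodule.span_mul_span, Submodule.span_le]
  rintro _ ⟨_, ⟨p, rfl⟩, _, ⟨h, rfl⟩, rfl⟩
  refine Submodule.subset_span ⟨(p.1, p.2 * h), ?_⟩
  simp [mul_assoc]

theorem filtration_zero : filtration D 0 = grpSpan D := by simp [filtration]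

theorem filtration_succ (n : ℕ) : filtration D (n + 1) = filtration D n * genSpan D := by
  rw [filtration, filtration, pow_succ, mul_assoc]

theorem filtration_mul_grpSpan (n : ℕ) : filtration D n * grpSpan D ≤ filtration D n := by
  cases n with
  | zero => simpa [filtration_zero] using grpSpan_mul_self D
  | succ n =>
    rw [filtration_succ, mul_assoc]
    exact mul_le_mul' le_rfl (genSpan_mul_grpSpan D)

theorem filtration_mono : Monotone (filtration D) := by
  refine monotone_nat_of_le_succ fun n a ha => ?_
  rw [filtration_succ]
  simpa using Submodule.mul_mem_mul ha (grpSpan_le_genSpan D (one_mem_grpSpan D))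

theorem exists_mem_filtration (a : Bos D) : ∃ n, a ∈ filtration D n := by
  -- Strengthened to right multiplication by `a`, so that the induction passes to products; `y = 1`
  -- recovers the claim.
  suffices h : ∀ n, ∀ y ∈ filtration D n, ∃ m, y * a ∈ filtration D m by
    simpa using h 0 1 (by simpa [filtration_zero] using one_mem_grpSpan D)
  induction a using Bos.induction with
  | hk c => exact fun n y hy => ⟨n, by
      rw [← Algebra.commutes, ← Algebra.smul_def]; exact Submodule.smul_mem _ _ hy⟩
  | hg g => exact fun n y hy => ⟨n, filtration_mul_grpSpan D n
      (Submodule.mul_mem_mul hy (grp_mem_grpSpan D g))⟩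
  | hx i => exact fun n y hy => ⟨n + 1, by
      rw [filtration_succ]; exact Submodule.mul_mem_mul hy (gen_mem_genSpan D i)⟩
  | hadd a b ha hb =>
    intro n y hy
    obtain ⟨m, hm⟩ := ha n y hy
    obtain ⟨l, hl⟩ := hb n y hy
    refine ⟨max m l, ?_⟩
    rw [mul_add]
    exact add_mem (filtration_mono D (le_max_left _ _) hm)
      (filtration_mono D (le_max_right _ _) hl)
  | hmul a b ha hb =>
    intro n y hy
    obtain ⟨m, hm⟩ := ha n y hy
    obtain ⟨l, hl⟩ := hb m _ hm
    exact ⟨l, by rwa [← mul_assoc]⟩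

end Bos

/-- The image of `M ⊗ N` in `A ⊗ A`. -/
def tensorSpan {k : Type u} {A : Type v} [Field k] [Ring A] [Algebra k A]
    (M N : Submodule k A) : Submodule k (A ⊗[k] A) :=
  Submodule.map₂ (TensorProduct.mk k A A) M N

theorem tmul_mem_tensorSpan {k : Type u} {A : Type v} [Field k] [Ring A] [Algebra k A]
    {M N : Submodule k A} {m n : A} (hm : m ∈ M) (hn : n ∈ N) : m ⊗ₜ[k] n ∈ tensorSpan M N :=
  Submodule.apply_mem_map₂ (TensorProduct.mk k A A) hm hn

theorem tensorSpan_mul {k : Type u} {A : Type v} [Field k] [Ring A] [Algebra k A]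
    (M N M' N' : Submodule k A) :
    tensorSpan M N * tensorSpan M' N' ≤ tensorSpan (M * M') (N * N') := by
  rw [Submodule.mul_le]
  intro a ha b hb
  refine Submodule.map₂_le (p := M) (q := N) (f := TensorProduct.mk k A A)
    (r := (tensorSpan (M * M') (N * N')).comap (LinearMap.mulRight k b)) |>.2 ?_ ha
  intro m hm n hn
  refine Submodule.map₂_le (p := M') (q := N') (f := TensorProduct.mk k A A)
    (r := (tensorSpan (M * M') (N * N')).comap (LinearMap.mulLeft k (m ⊗ₜ n))) |>.2 ?_ hb
  intro m' hm' n' hn'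
  simpa using tmul_mem_tensorSpan
    (Submodule.mul_mem_mul hm hm') (Submodule.mul_mem_mul hn hn')

theorem tensorSpan_mono {k : Type u} {A : Type v} [Field k] [Ring A] [Algebra k A]
    {M N M' N' : Submodule k A} (h : M ≤ M') (h' : N ≤ N') : tensorSpan M N ≤ tensorSpan M' N' :=
  Submodule.map₂_le_map₂ h h'

namespace Bos

variable {k : Type u} {Γ : Type v} {I : Type w} [Field k] [CommGroup Γ] (D : YDDatum k Γ I)

theorem comul_mem_of_mem_grpSpan {a : Bos D} (ha : a ∈ grpSpan D) :
    Coalgebra.comul (R := k) a ∈ tensorSpan (grpSpan D) (grpSpan D) := by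
  refine (Submodule.span_le (p := (tensorSpan (grpSpan D) (grpSpan D)).comap
    (Coalgebra.comul (R := k)))).2 ?_ ha
  rintro _ ⟨g, rfl⟩
  simpa using tmul_mem_tensorSpan
    (grp_mem_grpSpan D g) (grp_mem_grpSpan D g)

theorem comul_mem_of_mem_genSpan {a : Bos D} (ha : a ∈ genSpan D) :
    Coalgebra.comul (R := k) a ∈
      tensorSpan (genSpan D) (grpSpan D) ⊔ tensorSpan (grpSpan D) (genSpan D) := by
  refine (sup_le (c := (tensorSpan (genSpan D) (grpSpan D) ⊔
    tensorSpan (grpSpan D) (genSpan D)).comap (Coalgebra.comul (R := k))) ?_ ?_) ha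
  · exact fun a ha => Submodule.mem_sup_right
      (tensorSpan_mono le_rfl le_sup_left (comul_mem_of_mem_grpSpan D ha))
  · rw [Submodule.span_le]
    rintro _ ⟨⟨i, g⟩, rfl⟩
    have h : Coalgebra.comul (R := k) (gen D i * (grp D g).val) =
        (gen D i * (grp D g).val) ⊗ₜ[k] (grp D g).val +
          (grp D (D.deg i * g)).val ⊗ₜ[k] (gen D i * (grp D g).val) := by
      simp [add_mul]
    rw [SetLike.mem_coe, Submodule.mem_comap, h]
    exact Submodule.add_mem_sup
      (tmul_mem_tensorSpan
        (gen_mul_grp_mem_genSpan D i g) (grp_mem_grpSpan D g))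
      (tmul_mem_tensorSpan
        (grp_mem_grpSpan D _) (gen_mul_grp_mem_genSpan D i g))

/-- In a coproduct, either all the degree stays in the right leg and the left leg is in `kΓ`, or the
right leg drops by one. Induction multiplies by one more factor from `genSpan`, whose coproduct puts
the new `x_i` in one leg only. -/
theorem comul_mem_of_mem_filtration_succ (n : ℕ) : ∀ a ∈ filtration D (n + 1),
    Coalgebra.comul (R := k) a ∈
      tensorSpan (grpSpan D) (filtration D (n + 1)) ⊔ tensorSpan ⊤ (filtration D n) := by
  have step : ∀ (n : ℕ) (T T' : Submodule k (Bos D ⊗[k] Bos D)),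
      (∀ a ∈ filtration D n, Coalgebra.comul (R := k) a ∈ T) →
      T * (tensorSpan (genSpan D) (grpSpan D) ⊔ tensorSpan (grpSpan D) (genSpan D)) ≤ T' →
      ∀ a ∈ filtration D (n + 1), Coalgebra.comul (R := k) a ∈ T' := by
    intro n T T' hT hle a ha
    rw [filtration_succ] at ha
    refine (Submodule.mul_le (P := T'.comap (Coalgebra.comul (R := k)))).2 ?_ ha
    intro b hb c hc
    rw [Submodule.mem_comap, Bialgebra.comul_mul]
    exact hle (Submodule.mul_mem_mul (hT b hb) (comul_mem_of_mem_genSpan D hc))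
  -- A new `x_i` on the left leaves the right leg in degree `n`; on the right it raises that leg to
  -- `n + 1`.
  have base : ∀ n, tensorSpan (grpSpan D) (filtration D n) *
      (tensorSpan (genSpan D) (grpSpan D) ⊔ tensorSpan (grpSpan D) (genSpan D)) ≤
      tensorSpan (grpSpan D) (filtration D (n + 1)) ⊔ tensorSpan ⊤ (filtration D n) := by
    intro n
    rw [Submodule.mul_sup, sup_comm]
    refine sup_le_sup ((tensorSpan_mul _ _ _ _).trans (tensorSpan_mono (grpSpan_mul_self D) ?_))
      ((tensorSpan_mul _ _ _ _).trans (tensorSpan_mono le_top (filtration_mul_grpSpan D n)))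
    rw [filtration_succ]
  induction n with
  | zero =>
    refine step 0 _ _ (fun a ha => ?_) (base 0)
    rw [filtration_zero] at ha ⊢
    exact comul_mem_of_mem_grpSpan D ha
  | succ n ih =>
    refine step (n + 1) _ _ ih ?_
    rw [Submodule.sup_mul]
    refine sup_le (base _) (le_sup_of_le_right ?_)
    rw [Submodule.mul_sup]
    refine sup_le ((tensorSpan_mul _ _ _ _).trans (tensorSpan_mono le_top ?_))
      ((tensorSpan_mul _ _ _ _).trans (tensorSpan_mono le_top ?_))
    · exact (filtration_mul_grpSpan D n).trans (filtration_mono D n.le_succ)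
    · rw [filtration_succ]

/-- If `h` first appears in positive degree `n + 1`, slicing `Δ(h) = h ⊗ h` by a functional `f` that
kills degree `n` but not `h` gives `f(h) h ∈ kΓ`, contradicting minimality. -/
theorem groupLike_mem_grpSpan (h : GroupLike k (Bos D)) : h.val ∈ grpSpan D := by
  classical
  have hex := exists_mem_filtration D h.val
  rcases hn : Nat.find hex with _ | n
  · simpa [hn, filtration_zero] using Nat.find_spec hex
  · exfalso
    have hmem : h.val ∈ filtration D (n + 1) := hn ▸ Nat.find_spec hex
    have hnot : h.val ∉ filtration D n := Nat.find_min hex (by omega)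
    obtain ⟨f, hf, hle⟩ := Submodule.exists_le_ker_of_notMem hnot
    have hΔ := comul_mem_of_mem_filtration_succ D n _ hmem
    rw [h.2.comul_eq_tmul_self] at hΔ
    -- `id ⊗ f` sends the first summand into `kΓ` and annihilates the second.
    have hE : tensorSpan (grpSpan D) (filtration D (n + 1)) ⊔ tensorSpan ⊤ (filtration D n) ≤
        (grpSpan D).comap ((TensorProduct.rid k (Bos D)).toLinearMap ∘ₗ f.lTensor (Bos D)) := by
      refine sup_le (Submodule.map₂_le.2 ?_) (Submodule.map₂_le.2 ?_)
      · intro a ha b _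
        simpa using Submodule.smul_mem _ _ ha
      · intro a _ b hb
        have : f b = 0 := hle hb
        simp [this]
    have h1 := hE hΔ
    simp only [Submodule.mem_comap, LinearMap.comp_apply, LinearMap.lTensor_tmul,
      LinearEquiv.coe_coe, TensorProduct.rid_tmul] at h1
    rw [Submodule.smul_mem_iff _ hf] at h1
    exact hnot (filtration_mono D n.zero_le (by rwa [filtration_zero]))

/-- Distinct group-likes are linearly independent, so one lying in the span of `Γ` already belongs
to `Γ`. -/
theorem grp_surjective : Function.Surjective (grp D) := by
  intro h
  by_contra hne
  refine (linearIndep_groupLikeVal (R := k) (A := Bos D)).notMem_span_image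
    (s := Set.range (grp D)) (x := h) (fun ⟨g, hg⟩ => hne ⟨g, hg⟩) ?_
  rw [← Set.range_comp]
  exact groupLike_mem_grpSpan D h

/-- The group-like elements of `B(V) # kΓ` are the elements of `Γ`. -/
def grpEquiv : Γ ≃* GroupLike k (Bos D) :=
  MulEquiv.ofBijective (grp D) ⟨grp_injective D, grp_surjective D⟩

@[simp] theorem grp_grpEquiv_symm (h : GroupLike k (Bos D)) : grp D ((grpEquiv D).symm h) = h :=
  (grpEquiv D).apply_symm_apply h

@[simp] theorem grpEquiv_symm_grp (g : Γ) : (grpEquiv D).symm (grp D g) = g :=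
  (grpEquiv D).symm_apply_apply g

end Bos

/-! ### The universal grading and the characters of `H`. -/

namespace Bos

variable {k : Type u} {Γ : Type v} {I : Type w} [Field k] [CommGroup Γ] (D : YDDatum k Γ I)

@[simp] theorem grading_grp (g : Γ) :
    grading D (grp D g).val = MonoidAlgebra.of k _ (g : Γ ⧸ supp D) :=
  TBos.lift_grp (D := D) _ _ _ g

@[simp] theorem grading_gen (i : I) : grading D (gen D i) = 0 :=
  TBos.lift_gen (D := D) _ _ _ i

theorem deg_mem_supp (i : I) : D.deg i ∈ supp D := Subgroup.subset_closure ⟨i, rfl⟩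

@[simp] theorem mk_deg (i : I) : (D.deg i : Γ ⧸ supp D) = 1 :=
  (QuotientGroup.eq_one_iff _).2 (deg_mem_supp D i)

theorem grp_mem_coinvariants_iff (g : Γ) :
    (grp D g).val ∈ coinvariants (grading D) ↔ g ∈ supp D := by
  rw [coinvariants, Set.mem_ofPred_eq, comul_grp, TensorProduct.map_tmul, ← QuotientGroup.eq_one_iff]
  simp only [LinearMap.id_apply, LinearMap.coe_coe, grading_grp]
  constructor
  · intro h
    -- The counit on the first leg leaves `[g] = 1` in the group algebra.
    have h' := congrArg (TensorProduct.lid k _ ∘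
      (Coalgebra.counit (R := k) (A := Bos D)).rTensor (MonoidAlgebra k (Γ ⧸ supp D))) h
    simp only [Function.comp_apply, LinearMap.rTensor_tmul, counit_grp, TensorProduct.lid_tmul,
      one_smul] at h'
    exact MonoidAlgebra.of_injective (R := k) (h'.trans (map_one _).symm)
  · intro h
    rw [h, map_one]

theorem grp_mem_component (g : Γ) :
    (grp D g).val ∈ component (grading D) (g : Γ ⧸ supp D) := by
  simp [component]

theorem grading_surjective : Function.Surjective (grading D) := by
  intro y
  induction y using MonoidAlgebra.induction_on with
  | of g =>
    obtain ⟨g, rfl⟩ := QuotientGroup.mk_surjective g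
    exact ⟨_, grading_grp D g⟩
  | add a b ha hb =>
    obtain ⟨a, rfl⟩ := ha
    obtain ⟨b, rfl⟩ := hb
    exact ⟨a + b, map_add _ _ _⟩
  | smul c a ha =>
    obtain ⟨a, rfl⟩ := ha
    exact ⟨c • a, map_smul _ _ _⟩

/-- Both sides are algebra maps, so generators suffice; on `x_i` they agree because `[g_i] = 1` and
`x_i ↦ 0`. -/
theorem grading_isCocentral : IsCocentral (grading D) := by
  have key : (Algebra.TensorProduct.map (AlgHom.id k (Bos D)) (grading D : Bos D →ₐ[k] MonoidAlgebra k (Γ ⧸ supp D))).comp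
      (Bialgebra.comulAlgHom k (Bos D)) =
      (Algebra.TensorProduct.map (AlgHom.id k (Bos D)) (grading D : Bos D →ₐ[k] MonoidAlgebra k (Γ ⧸ supp D))).comp
      ((Algebra.TensorProduct.comm k (Bos D) (Bos D)).toAlgHom.comp
        (Bialgebra.comulAlgHom k (Bos D))) := by
    refine algHom_ext (fun g => ?_) (fun i => ?_)
    · simp
    · simp [-MonoidAlgebra.of_apply]
  exact fun h => DFunLike.congr_fun key h

/-- A linear form on `B(V) # kΓ` sending `1` to `1` and vanishing on the other elements of `Γ`
and on the `x_i`. -/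
def coeffOne : Bos D →ₗ[k] k :=
  (Finsupp.lapply (1 : Γ) ∘ₗ (MonoidAlgebra.coeffLinearEquiv k).toLinearMap) ∘ₗ
    (toGroupAlgebra D).toLinearMap

@[simp] theorem coeffOne_one : coeffOne D 1 = 1 := by
  simp [coeffOne, MonoidAlgebra.one_def]

@[simp] theorem coeffOne_gen (i : I) : coeffOne D (gen D i) = 0 := by
  simp [coeffOne]

theorem coeffOne_grp_of_ne {g : Γ} (hg : g ≠ 1) : coeffOne D (grp D g).val = 0 := by
  simp [coeffOne, Finsupp.single_eq_of_ne hg.symm]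

/-- The algebra map `H → k` extending a character of `Γ` by `x_i ↦ 0`. -/
def extendChar (χ : Γ →* kˣ) : Bos D →ₐ[k] k :=
  lift ((Units.coeHom k).comp χ) (fun _ => 0) (by simp) (by simp)

@[simp] theorem extendChar_grp (χ : Γ →* kˣ) (g : Γ) : extendChar D χ (grp D g).val = χ g :=
  lift_grp _ _ _ _ g

@[simp] theorem extendChar_gen (χ : Γ →* kˣ) (i : I) : extendChar D χ (gen D i) = 0 :=
  lift_gen _ _ _ _ i

/-- The restriction of an algebra map `H → k` to `Γ`. -/
def restrictChar : WithConv (Bos D →ₐ[k] k) →* (Γ →* kˣ) where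
  toFun γ := ((γ.ofConv : Bos D →* k).comp ((GroupLike.valMonoidHom k (Bos D)).comp
    (grp D))).toHomUnits
  map_one' := by
    ext g
    simp [AlgHom.convOne_def]
  map_mul' γ γ' := by
    ext g
    simp [AlgHom.convMul_apply]

@[simp] theorem restrictChar_apply (γ : WithConv (Bos D →ₐ[k] k)) (g : Γ) :
    (restrictChar D γ g : k) = γ.ofConv (grp D g).val := rfl

variable {D}

/-- In the commutative target, `g_i x_i = -x_i g_i` becomes `2 γ(g_i) γ(x_i) = 0`, and `γ(g_i)` is
invertible. -/
theorem algHom_gen_eq_zero (hk : (2 : k) ≠ 0) (hD : ∀ i, D.char i (D.deg i) = -1)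
    (γ : Bos D →ₐ[k] k) (i : I) : γ (gen D i) = 0 := by
  have h := congrArg γ (grp_mul_gen D (D.deg i) i)
  rw [hD, map_smul, map_mul, map_mul, Units.val_neg, Units.val_one, neg_smul, one_smul,
    mul_comm (γ (gen D i)), ← add_eq_zero_iff_eq_neg, ← two_mul] at h
  have hu : γ (grp D (D.deg i)).val ≠ 0 := by
    rw [← restrictChar_apply D (toConv γ)]
    exact Units.ne_zero _
  simpa [hk, hu] using h

/-- If `χ_i(g_i) = -1 ≠ 1`, then the algebra maps `H → k` are the characters of `Γ`. -/
def charEquiv (hk : (2 : k) ≠ 0) (hD : ∀ i, D.char i (D.deg i) = -1) :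
    WithConv (Bos D →ₐ[k] k) ≃* (Γ →* kˣ) where
  toFun := restrictChar D
  invFun χ := toConv (extendChar D χ)
  left_inv γ := by
    refine WithConv.ext (algHom_ext (fun g => ?_) (fun i => ?_))
    · simp
    · simp [algHom_gen_eq_zero hk hD]
  right_inv χ := by
    ext g
    simp
  map_mul' := map_mul _

theorem deg_ne_one (hk : (2 : k) ≠ 0) (hD : ∀ i, D.char i (D.deg i) = -1) (i : I) :
    D.deg i ≠ 1 := by
  intro h
  have h1 := congrArg Units.val (hD i)
  rw [h, map_one, Units.val_neg, Units.val_one] at h1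
  exact hk (by linear_combination h1)

/-- A bialgebra map carries `Γ` to group-likes of `kG'`, that is, to `G'`. Cocentrality at `x_i`
then forces the resulting homomorphism to kill `supp V`. -/
theorem isUniversalGrading_grading (hk : (2 : k) ≠ 0) (hD : ∀ i, D.char i (D.deg i) = -1) :
    IsUniversalGrading.{_, _, _, x} (grading D) where
  surjective := grading_surjective D
  cocentral := grading_isCocentral D
  universal := by
    intro G' _ ρ hρ
    have hgrp : ∀ g, ∃ s, MonoidAlgebra.of k G' s = ρ (grp D g).val := fun g =>
      MonoidAlgebra.isGroupLikeElem_iff_mem_range_of.1 ((grp D g).2.map ρ)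
    choose f hf using hgrp
    have hgen : ∀ i, gen D i ⊗ₜ[k] (1 : MonoidAlgebra k G') +
        (grp D (D.deg i)).val ⊗ₜ[k] ρ (gen D i) =
        1 ⊗ₜ[k] ρ (gen D i) + gen D i ⊗ₜ[k] ρ (grp D (D.deg i)).val := by
      intro i
      simpa using hρ (gen D i)
    -- `coeffGen` kills `1` and `g_i`, so only the two terms with left leg `x_i` survive.
    have hdeg : ∀ i, ρ (grp D (D.deg i)).val = 1 := by
      intro i
      have h := congrArg (TensorProduct.lid k _ ∘
        (coeffGen D i).rTensor (MonoidAlgebra k G')) (hgen i)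
      simpa using h.symm
    -- `coeffOne` kills `x_i`, and also `g_i` because `g_i ≠ 1`; only `1 ⊗ ρ(x_i)` survives.
    have hzero : ∀ i, ρ (gen D i) = 0 := by
      intro i
      have h := congrArg (TensorProduct.lid k _ ∘
        (coeffOne D).rTensor (MonoidAlgebra k G')) (hgen i)
      simpa [coeffOne_grp_of_ne D (deg_ne_one hk hD i)] using h.symm
    let φ : Γ →* G' :=
      { toFun := f
        map_one' := MonoidAlgebra.of_injective (R := k) (by simp only [hf, map_one, GroupLike.val_one])
        map_mul' := fun a b => MonoidAlgebra.of_injective (R := k) (by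
          simp only [hf, map_mul, GroupLike.val_mul]) }
    have hφ : supp D ≤ φ.ker := by
      rw [supp, Subgroup.closure_le]
      rintro _ ⟨i, rfl⟩
      exact MonoidAlgebra.of_injective (R := k) ((hf _).trans ((hdeg i).trans (map_one _).symm))
    refine ⟨QuotientGroup.lift (supp D) φ hφ, ?_, ?_⟩
    · refine BialgHom.coe_toAlgHom_injective (algHom_ext (fun g => ?_) (fun i => ?_))
      · refine Eq.trans ?_ (hf g)
        change MonoidAlgebra.mapDomainBialgHom k (QuotientGroup.lift (supp D) φ hφ)
          (grading D (grp D g).val) = _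
        simp [φ]
      · refine Eq.trans ?_ (hzero i).symm
        change MonoidAlgebra.mapDomainBialgHom k (QuotientGroup.lift (supp D) φ hφ)
          (grading D (gen D i)) = _
        simp
    · intro ψ hψ
      ext g
      apply MonoidAlgebra.of_injective (R := k)
      have h := DFunLike.congr_fun hψ (grp D g).val
      rw [BialgHom.comp_apply, grading_grp, ← hf] at h
      simpa [φ] using h

end Bos

/-! ### Convolution inverses of forms at group-like elements. -/

section Form

variable {k : Type u} {H : Type v} [Field k] [Ring H] [HopfAlgebra k H]
  {r : (WithConv (H ⊗[k] H →ₗ[k] k))ˣ}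

/-- Since `Δ(g) = g ⊗ g`, fixing the first variable at `g` turns convolution on `H ⊗ H` into
convolution on `H`. -/
theorem convMul_form_inv (g : GroupLike k H) :
    toConv (form r g.val) * toConv (form r⁻¹ g.val) = 1 := by
  ext h
  have h1 := LinearMap.congr_fun (congrArg WithConv.ofConv r.mul_inv) (g.val ⊗ₜ[k] h)
  have h2 : ∀ t : H ⊗[k] H, LinearMap.mul' k k (TensorProduct.map r.val.ofConv (r⁻¹).val.ofConv
      (TensorProduct.AlgebraTensorModule.tensorTensorTensorComm k k k k H H H H
        ((g.val ⊗ₜ[k] g.val) ⊗ₜ[k] t))) =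
      LinearMap.mul' k k (TensorProduct.map (form r g.val) (form r⁻¹ g.val) t) := by
    intro t
    induction t using TensorProduct.induction_on with
    | zero => simp
    | add t t' ht ht' => rw [TensorProduct.tmul_add, map_add, map_add, map_add, ht, ht',
        map_add, map_add]
    | tmul a b => rfl
  refine (h2 _).symm.trans ?_
  rw [← g.2.comul_eq_tmul_self]
  refine Eq.trans h1 ?_
  change Coalgebra.counit (R := k) (g.val ⊗ₜ[k] h) = Coalgebra.counit (R := k) h
  simp

theorem form_mul_form_inv (g h : GroupLike k H) :
    form r g.val h.val * form r⁻¹ g.val h.val = 1 := by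
  have h1 := LinearMap.congr_fun (congrArg WithConv.ofConv (convMul_form_inv (r := r) g)) h.val
  simpa [LinearMap.convMul_def, LinearMap.convOne_def] using h1

end Form

/-! ### The centrality axiom for `γ`. -/

namespace Bos

variable {k : Type u} {Γ : Type v} {I : Type w} [Field k] [CommGroup Γ] {D : YDDatum k Γ I}

/-- The two contractions of `Δ` with `γ` are algebra maps `L` and `R`, and `L(h) g = g R(h)` is
stable under products. It is automatic on `Γ`; on `x_i` it compares `γ(g_i) x_i g` with `χ_i(g) x_i
g`. -/
theorem central_iff {γ : Bos D →ₐ[k] k} (hγ : ∀ i, γ (gen D i) = 0) (g : Γ) :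
    (∀ h : Bos D, TensorProduct.lid k (Bos D) (TensorProduct.map γ.toLinearMap LinearMap.id
        (Coalgebra.comul (R := k) h)) * (grp D g).val =
      (grp D g).val * TensorProduct.rid k (Bos D) (TensorProduct.map LinearMap.id γ.toLinearMap
        (Coalgebra.comul (R := k) h))) ↔
    ∀ i, (D.char i g : k) = γ (grp D (D.deg i)).val := by
  let L : Bos D →ₐ[k] Bos D := (Algebra.TensorProduct.lid k (Bos D)).toAlgHom.comp
    ((Algebra.TensorProduct.map γ (AlgHom.id k (Bos D))).comp (Bialgebra.comulAlgHom k (Bos D)))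
  let R : Bos D →ₐ[k] Bos D := (Algebra.TensorProduct.rid k k (Bos D)).toAlgHom.comp
    ((Algebra.TensorProduct.map (AlgHom.id k (Bos D)) γ).comp (Bialgebra.comulAlgHom k (Bos D)))
  change (∀ h, L h * (grp D g).val = (grp D g).val * R h) ↔ _
  have hLg : ∀ h, L (grp D h).val = γ (grp D h).val • (grp D h).val := fun h => by simp [L]
  have hRg : ∀ h, R (grp D h).val = γ (grp D h).val • (grp D h).val := fun h => by simp [R]
  have hLx : ∀ i, L (gen D i) = γ (grp D (D.deg i)).val • gen D i := fun i => by simp [L, hγ]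
  have hRx : ∀ i, R (gen D i) = gen D i := fun i => by simp [R, hγ]
  constructor
  · intro H i
    have h := H (gen D i)
    rw [hLx, hRx, grp_mul_gen, smul_mul_assoc] at h
    exact (smul_left_injective k (gen_mul_grp_ne_zero D i g) h).symm
  · intro H h
    induction h using Bos.induction with
    | hk c => rw [AlgHom.commutes, AlgHom.commutes, Algebra.commutes]
    | hg h =>
      rw [hLg, hRg, smul_mul_assoc, mul_smul_comm, ← GroupLike.val_mul, ← GroupLike.val_mul,
        ← map_mul, ← map_mul, mul_comm]
    | hx i => rw [hLx, hRx, grp_mul_gen, smul_mul_assoc, H]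
    | hadd a b ha hb => rw [map_add, map_add, add_mul, mul_add, ha, hb]
    | hmul a b ha hb => rw [map_mul, map_mul, mul_assoc, hb, ← mul_assoc, ha, mul_assoc]

end Bos

/-! ### Universal forms evaluated at group-likes, and induced characters. -/

section Form

variable {k : Type u} {H : Type v} [Field k] [Ring H] [HopfAlgebra k H]
  {r : (WithConv (H ⊗[k] H →ₗ[k] k))ˣ}

/-- Apply the counit to the second leg of the equation defining `H_s`. This turns a character of
`G`, composed with `π`, into the right side of the character-inducing condition. -/
theorem apply_of_mem_component {G : Type w} [Group G] {π : H →ₐc[k] MonoidAlgebra k G} {s : G}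
    {a : H} (ha : a ∈ component π s) :
    π a = Coalgebra.counit (R := k) a • MonoidAlgebra.of k G s := by
  have h := congrArg (TensorProduct.rid k (MonoidAlgebra k G) ∘
    (Coalgebra.counit (R := k) (A := H)).lTensor (MonoidAlgebra k G)) ha
  have h' : (Coalgebra.counit (R := k) (A := H)).lTensor (MonoidAlgebra k G) ∘ₗ
      TensorProduct.map (π : H →ₗ[k] MonoidAlgebra k G) LinearMap.id =
      (π : H →ₗ[k] MonoidAlgebra k G).rTensor k ∘ₗ
        (Coalgebra.counit (R := k) (A := H)).lTensor H := by
    ext; simp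
  rw [Function.comp_apply, ← LinearMap.comp_apply, h', LinearMap.comp_apply,
    Coalgebra.lTensor_counit_comul] at h
  simpa using h

/-- For `g` group-like, `r(-, g)` is an algebra map. -/
def IsUniversalRForm.leftHom (hr : IsUniversalRForm r) (g : GroupLike k H)
    (h1 : form r 1 g.val = 1) : H →ₐ[k] k :=
  AlgHom.ofLinearMap ((form r).flip g.val) h1 (fun a b => by
    simp [hr.mul_left])

/-- For `g` group-like, `r(g, -)` is an algebra map. -/
def IsUniversalRForm.rightHom (hr : IsUniversalRForm r) (g : GroupLike k H)
    (h1 : form r g.val 1 = 1) : H →ₐ[k] k :=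
  AlgHom.ofLinearMap (form r g.val) h1 (fun a b => by
    simp [hr.mul_right, mul_comm])

end Form

namespace BraidingTriple

variable {k : Type u} {Γ : Type v} {I : Type w} [Field k] [CommGroup Γ] (P : BraidingTriple k Γ I)

theorem char_deg (i : I) : P.yd.char i (P.yd.deg i) = -1 := P.minus i

theorem char_eq (i : I) (g : Γ) : P.yd.char i g = (P.r₀ g (P.deg i))⁻¹ := P.symm i g

variable {P} {r : (WithConv (P.H ⊗[k] P.H →ₗ[k] k))ˣ}

namespace IsRForm

theorem form_grp_one (hr : P.IsRForm r) (g : Γ) : form r (Bos.grp P.yd g).val 1 = 1 := by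
  simpa using hr.grp g 1

theorem form_one_grp (hr : P.IsRForm r) (g : Γ) : form r 1 (Bos.grp P.yd g).val = 1 := by
  simpa using hr.grp 1 g

/-- The form `x ↦ r(x₁, g) r(g, x₂)` is a convolution product of algebra maps, hence itself an
algebra map, and so is `χ ∘ π`. By `charEquiv` they agree as soon as they agree on `Γ`. -/
theorem inducesCharacter_iff (hr : P.IsRForm r) (hk : (2 : k) ≠ 0) (g : Γ) (χ : P.U →* kˣ) :
    InducesCharacter r P.π (Bos.grp P.yd g) χ ↔ ∀ h : Γ, χ h = P.r₀ g h * P.r₀ h g := by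
  constructor
  · intro H h
    have h1 := H _ _ (Bos.grp_mem_component P.yd h)
    rw [Bos.comul_grp, TensorProduct.map_tmul, LinearMap.mul'_apply, LinearMap.flip_apply,
      hr.grp, hr.grp, Bos.counit_grp, mul_one] at h1
    rw [mul_comm]
    exact Units.ext (by simpa using h1.symm)
  · intro H s a ha
    have key : toConv (hr.isUniversalRForm.leftHom (Bos.grp P.yd g) (hr.form_one_grp g)) *
        toConv (hr.isUniversalRForm.rightHom (Bos.grp P.yd g) (hr.form_grp_one g)) =
        toConv ((MonoidAlgebra.lift k k P.U ((Units.coeHom k).comp χ)).comp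
          (P.π : P.H →ₐ[k] MonoidAlgebra k P.U)) := by
      refine (Bos.charEquiv hk P.char_deg).injective ?_
      ext h
      rw [map_mul]
      refine Eq.trans (congrArg₂ (· * ·) (hr.grp h g) (hr.grp g h)) ?_
      change _ = MonoidAlgebra.lift k k P.U ((Units.coeHom k).comp χ)
        (P.π (Bos.grp P.yd h).val)
      simp [H, mul_comm]
    have h1 := DFunLike.congr_fun (congrArg WithConv.ofConv key) a
    refine Eq.trans h1 ?_
    change MonoidAlgebra.lift k k P.U ((Units.coeHom k).comp χ) (P.π a) = _
    rw [apply_of_mem_component ha]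
    simp [mul_comm]

/-- The condition `r₀(g_i, -) = r₀(-, g_i)⁻¹` makes `h ↦ r₀(g, h) r₀(h, g)` trivial on `supp V`.
Thus every element of `Γ` is character-inducing, which is why the tuple side needs no such
condition. -/
theorem exists_inducesCharacter (hr : P.IsRForm r) (hk : (2 : k) ≠ 0) (g : Γ) :
    ∃ χ : P.U →* kˣ, InducesCharacter r P.π (Bos.grp P.yd g) χ := by
  have hle : Bos.supp P.yd ≤ (P.r₀ g * P.r₀.flip g).ker := by
    rw [Bos.supp, Subgroup.closure_le]
    rintro _ ⟨i, rfl⟩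
    change P.r₀ g (P.deg i) * P.r₀ (P.deg i) g = 1
    rw [P.symm, mul_inv_cancel]
  exact ⟨QuotientGroup.lift _ _ hle, (hr.inducesCharacter_iff hk g _).2 fun h => rfl⟩

/-- Agreement on `Γ` makes `γ` a convolution inverse of the algebra map `r(g, -)`; `r⁻¹(g, -)` is
another, and inverses are unique. -/
theorem eq_form_inv_iff (hr : P.IsRForm r) (hk : (2 : k) ≠ 0) (γ : P.H →ₐ[k] k) (g : Γ) :
    (∀ a : P.H, γ a = form r⁻¹ (Bos.grp P.yd g).val a) ↔
      ∀ h : Γ, γ (Bos.grp P.yd h).val = ((P.r₀ g h)⁻¹ : kˣ) := by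
  constructor
  · intro H h
    have h1 := form_mul_form_inv (r := r) (Bos.grp P.yd g) (Bos.grp P.yd h)
    rw [← H, hr.grp] at h1
    rw [Units.val_inv_eq_inv_val]
    exact eq_inv_of_mul_eq_one_right h1
  · intro H
    have key : toConv γ *
        toConv (hr.isUniversalRForm.rightHom (Bos.grp P.yd g) (hr.form_grp_one g)) = 1 := by
      refine (Bos.charEquiv hk P.char_deg).injective ?_
      ext h
      rw [map_mul, map_one]
      refine Eq.trans (congrArg₂ (· * ·) (H h) (hr.grp g h)) ?_
      simp
    -- `r⁻¹(g, -)` is only given as a linear form, so the inverses are compared in the convolution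
    -- algebra of linear forms.
    have key' : toConv γ.toLinearMap * toConv (form r (Bos.grp P.yd g).val) = 1 :=
      congrArg (fun f : WithConv (P.H →ₐ[k] k) => toConv f.ofConv.toLinearMap) key
    have h := left_inv_eq_right_inv key' (convMul_form_inv (r := r) (Bos.grp P.yd g))
    exact fun a => LinearMap.congr_fun (congrArg WithConv.ofConv h) a

end IsRForm
end BraidingTriple

/-- Allows the two `λ`, valued in different subgroups, to be compared inside `G(H)`. -/
theorem IsNormalizedTwoCocycle.map_iff {G : Type w} [Group G] {A : Type u} {B : Type v} [Group A]
    [Group B] {F : Type x} [FunLike F A B] [MonoidHomClass F A B] (φ : F)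
    (hφ : Function.Injective φ) (f : G → G → A) :
    IsNormalizedTwoCocycle (fun a b => φ (f a b)) ↔ IsNormalizedTwoCocycle f := by
  have h1 : ∀ a, φ a = 1 ↔ a = 1 := fun a => map_eq_one_iff φ hφ
  exact ⟨fun h => ⟨fun a => (h1 _).1 (h.one_left a), fun a => (h1 _).1 (h.one_right a),
      fun a b c => hφ (by simpa using h.cocycle a b c)⟩,
    fun h => ⟨fun a => (h1 _).2 (h.one_left a), fun a => (h1 _).2 (h.one_right a),
      fun a b c => by rw [← map_mul, h.cocycle, map_mul]⟩⟩

/-! ### The correspondence between zesting data and tuples. -/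

namespace FiveTuple

variable {k : Type u} {Γ : Type v} {I : Type w} [Field k] [CommGroup Γ] {P : BraidingTriple k Γ I}
  {r : (WithConv (P.H ⊗[k] P.H →ₗ[k] k))ˣ} {Z Z' : ZestingData k P.H P.U}
  {T T' : FiveTuple k Γ P.U}

namespace Corresponds

theorem tuple_unique (h : Corresponds P Z T) (h' : Corresponds P Z T') : T = T' := by
  have hΓ : T.Γ₀ = T'.Γ₀ := Subgroup.ext fun g => (h.mem_iff g).symm.trans (h'.mem_iff g)
  rcases T with ⟨Γ₀, Φ, lam, om, t⟩
  rcases T' with ⟨Γ₀', Φ', lam', om', t'⟩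
  obtain rfl : Γ₀ = Γ₀' := hΓ
  obtain rfl : Φ = Φ' := by
    ext g a
    exact (h.gamma g a).symm.trans (h'.gamma g a)
  obtain rfl : lam = lam' := by
    funext a b
    exact Subtype.ext (Bos.grp_injective P.yd ((h.lam a b).symm.trans (h'.lam a b)))
  obtain rfl : om = om' := h.om.symm.trans h'.om
  obtain rfl : t = t' := h.t.symm.trans h'.t
  rfl

/-- Surjectivity of `Γ → G(H)` recovers the subgroup, and injectivity of restriction to `Γ` recovers
`γ`. -/
theorem data_unique (hk : (2 : k) ≠ 0) (h : Corresponds P Z T) (h' : Corresponds P Z' T) :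
    Z = Z' := by
  have hΓ : Z.Γ₀ = Z'.Γ₀ := Subgroup.ext fun g => by
    obtain ⟨g, rfl⟩ := Bos.grp_surjective P.yd g
    exact (h.mem_iff g).trans (h'.mem_iff g).symm
  rcases Z with ⟨Γ₀, γ, lam, om, t⟩
  rcases Z' with ⟨Γ₀', γ', lam', om', t'⟩
  obtain rfl : Γ₀ = Γ₀' := hΓ
  obtain rfl : γ = γ' := by
    refine MonoidHom.ext fun ⟨g, hg⟩ => (Bos.charEquiv hk P.char_deg).injective ?_
    obtain ⟨g, rfl⟩ := Bos.grp_surjective P.yd g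
    ext a
    exact (h.gamma ⟨g, (h.mem_iff g).1 hg⟩ a).trans (h'.gamma ⟨g, (h.mem_iff g).1 hg⟩ a).symm
  obtain rfl : lam = lam' := by
    funext a b
    exact Subtype.ext ((h.lam a b).trans (h'.lam a b).symm)
  obtain rfl : om = om' := h.om.trans h'.om.symm
  obtain rfl : t = t' := h.t.trans h'.t.symm
  rfl

theorem lam_eq (h : Corresponds P Z T) (a b : P.U) :
    Z.lam a b = ⟨Bos.grp P.yd (T.lam a b), (h.mem_iff _).2 (T.lam a b).2⟩ :=
  Subtype.ext (h.lam a b)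

theorem forall_mem_iff (h : Corresponds P Z T) {p : Z.Γ₀ → Prop} :
    (∀ g, p g) ↔ ∀ g : T.Γ₀, p ⟨Bos.grp P.yd g, (h.mem_iff _).2 g.2⟩ := by
  refine ⟨fun H g => H _, fun H ⟨g, hg⟩ => ?_⟩
  obtain ⟨g, rfl⟩ := Bos.grp_surjective P.yd g
  exact H ⟨g, (h.mem_iff g).1 hg⟩

theorem isNormalizedTwoCocycle_iff (h : Corresponds P Z T) :
    IsNormalizedTwoCocycle Z.lam ↔ IsNormalizedTwoCocycle T.lam := by
  rw [← IsNormalizedTwoCocycle.map_iff Z.Γ₀.subtype Z.Γ₀.subtype_injective,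
    ← IsNormalizedTwoCocycle.map_iff ((Bos.grp P.yd).comp T.Γ₀.subtype)
      ((Bos.grp_injective P.yd).comp T.Γ₀.subtype_injective)]
  exact iff_of_eq (congrArg _ (funext₂ h.lam))

/-- The axioms match one by one: coinvariance with `Γ₀ ≤ supp V`, centrality with the action
condition, and the induced character with the symmetrized `r₀`. -/
theorem isAdmissible_iff (hk : (2 : k) ≠ 0) (hr : P.IsRForm r) (h : Corresponds P Z T) :
    Z.IsAssociative P.π ∧ Z.SatisfiesBZ r P.π ↔ T.IsAdmissible P := by
  have hcoinv : (∀ g ∈ Z.Γ₀, g.val ∈ coinvariants P.π) ↔ T.Γ₀ ≤ Bos.supp P.yd := by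
    rw [← Subtype.forall (p := (· ∈ Z.Γ₀)) (q := fun g => g.1.val ∈ coinvariants P.π),
      h.forall_mem_iff]
    simp only [Bos.grp_mem_coinvariants_iff]
    exact ⟨fun H g hg => H ⟨g, hg⟩, fun H g => H g.2⟩
  have hact := (h.forall_mem_iff (p := fun g => ∀ a : P.H,
      TensorProduct.lid k P.H (TensorProduct.map (Z.γ g).ofConv.toLinearMap LinearMap.id
        (Coalgebra.comul (R := k) a)) * g.1.val =
      g.1.val * TensorProduct.rid k P.H (TensorProduct.map LinearMap.id
        (Z.γ g).ofConv.toLinearMap (Coalgebra.comul (R := k) a)))).trans (forall_congr' fun g : T.Γ₀ =>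
    (Bos.central_iff (Bos.algHom_gen_eq_zero hk P.char_deg (Z.γ ⟨_, (h.mem_iff _).2 g.2⟩).ofConv)
      g.1).trans (forall_congr' fun i => by rw [h.gamma, Units.val_inj]))
  have hcompat : ∀ a b c d, (Z.γ (Z.lam a b)).ofConv (Z.lam c d : GroupLike k P.H).val =
      T.Φ (T.lam a b) (T.lam c d) := by
    intro a b c d
    rw [h.lam_eq a b, h.lam, h.gamma]
  have hχ := hr.inducesCharacter_iff hk
  constructor
  · rintro ⟨hA, hB⟩
    have hphi := hact.1 hA.central
    refine ⟨hcoinv.1 hA.mem_coinvariants, fun g i => ?_, hphi,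
      h.isNormalizedTwoCocycle_iff.1 hA.lam_cocycle, h.om ▸ hA.om_normalized, fun a b c d => ?_,
      ?_, fun a b g => ?_⟩
    -- The conditions `phi_deg` and `phi_act` coincide, since `χ_i(g) = r₀(g, g_i)⁻¹`.
    · rw [← P.char_eq]; exact hphi g i
    · rw [← h.om]
      exact Units.ext ((hcompat a b c d).symm.trans (hA.compat a b c d))
    · rw [← h.om, ← h.t]
      exact hB.bz2
    · obtain ⟨χ, h1, h2⟩ := hB.bz3 a b
      rw [h.lam, hχ] at h1
      rw [← h1, h2, h.om, h.t]
  · intro hT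
    refine ⟨⟨hcoinv.2 hT.le_supp, hact.2 hT.phi_act,
      h.isNormalizedTwoCocycle_iff.2 hT.lam_cocycle, h.om ▸ hT.om_normalized, fun a b c d => ?_⟩,
      ?_, fun a b => ?_⟩
    · rw [hcompat, hT.compat, h.om]
    · rw [h.om, h.t]
      exact hT.bz2
    -- The character exists unconditionally; its value at a class is read off from any
    -- representative in `Γ`.
    · obtain ⟨χ, h1⟩ := hr.exists_inducesCharacter hk (T.lam a b)
      refine ⟨χ, (h.lam a b).symm ▸ h1, fun c => ?_⟩
      obtain ⟨g, rfl⟩ := QuotientGroup.mk_surjective c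
      rw [(hχ _ _).1 h1 g, hT.bz3, h.om, h.t]

theorem isBraided_iff (hk : (2 : k) ≠ 0) (hr : P.IsRForm r) (h : Corresponds P Z T) :
    Z.IsBraided r P.π ↔ T.IsAdmissible P ∧ T.IsCompatible P := by
  have hsymm : (∀ a b, Z.lam a b = Z.lam b a) ↔ ∀ a b, T.lam a b = T.lam b a :=
    forall₂_congr fun a b => by
      rw [h.lam_eq, h.lam_eq, Subtype.mk.injEq, (Bos.grp_injective P.yd).eq_iff, Subtype.val_inj]
  have hphi := (h.forall_mem_iff (p := fun g => ∀ a : P.H,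
      (Z.γ g).ofConv a = form r⁻¹ g.1.val a)).trans (forall_congr' fun g : T.Γ₀ =>
    (hr.eq_form_inv_iff hk (Z.γ ⟨_, (h.mem_iff _).2 g.2⟩).ofConv g).trans
      (forall_congr' fun a => by rw [h.gamma, Units.val_inj]))
  rw [← h.isAdmissible_iff hk hr]
  exact ⟨fun H => ⟨⟨H.isAssociative, H.satisfiesBZ⟩, hsymm.1 H.lam_symm, hphi.1 H.gamma_eq⟩,
    fun H => ⟨mul_comm, H.1.1, hphi.2 H.2.phi_eq, hsymm.2 H.2.lam_symm, H.1.2⟩⟩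

end Corresponds

theorem exists_tuple_corresponds (Z : ZestingData k P.H P.U) : ∃ T, Corresponds P Z T := by
  refine ⟨⟨Z.Γ₀.comap (Bos.grp P.yd), (Bos.restrictChar P.yd).comp (Z.γ.comp
      ((Bos.grp P.yd).subgroupComap Z.Γ₀)),
    fun a b => ⟨(Bos.grpEquiv P.yd).symm (Z.lam a b), ?_⟩, Z.om, Z.t⟩,
    ⟨fun g => Iff.rfl, fun g a => rfl, fun a b => ?_, rfl, rfl⟩⟩
  · simp
  · simp

theorem exists_data_corresponds (hk : (2 : k) ≠ 0) (T : FiveTuple k Γ P.U) :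
    ∃ Z, Corresponds P Z T := by
  let e : T.Γ₀.comap (Bos.grpEquiv P.yd).symm.toMonoidHom →* T.Γ₀ :=
    (Bos.grpEquiv P.yd).symm.toMonoidHom.subgroupComap T.Γ₀
  -- `e` identifies the copy of `Γ₀` in `G(H)` with `Γ₀`; `γ` is then `Φ` extended by zero on the
  -- `x_i`.
  have he : ∀ g : T.Γ₀, ∀ hg, e ⟨Bos.grp P.yd g, hg⟩ = g := fun g hg =>
    Subtype.ext (Bos.grpEquiv_symm_grp P.yd g)
  refine ⟨⟨T.Γ₀.comap (Bos.grpEquiv P.yd).symm.toMonoidHom,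
    (Bos.charEquiv hk P.char_deg).symm.toMonoidHom.comp (T.Φ.comp e),
    fun a b => ⟨Bos.grp P.yd (T.lam a b), ?_⟩, T.om, T.t⟩,
    ⟨fun g => ?_, fun g a => ?_, fun a b => rfl, rfl, rfl⟩⟩
  · simp
  · simp
  · refine (Bos.extendChar_grp P.yd _ a).trans ?_
    rw [MonoidHom.comp_apply, he]

end FiveTuple

end

end Zesting

theorem mainTheorem9 {k : Type u} [Field k] (hk : (2 : k) ≠ 0)
    {Γ : Type v} [CommGroup Γ] [Finite Γ] {I : Type w} [Finite I]
    (P : Zesting.BraidingTriple k Γ I)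
    (r : (WithConv (TensorProduct k P.H P.H →ₗ[k] k))ˣ) (hr : P.IsRForm r) :
    -- `U(H) = Γ / supp V` is the universal grading group of `H`
    Zesting.IsUniversalGrading.{_, _, _, x} P.π ∧
    -- braided `U(H)`-zestings correspond bijectively to tuples
    ((∀ Z : Zesting.ZestingData k P.H P.U, Z.IsBraided r P.π →
        ∃! T : Zesting.FiveTuple k Γ P.U,
          (T.IsAdmissible P ∧ T.IsCompatible P) ∧ Zesting.FiveTuple.Corresponds P Z T) ∧
      ∀ T : Zesting.FiveTuple k Γ P.U, T.IsAdmissible P ∧ T.IsCompatible P →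
        ∃! Z : Zesting.ZestingData k P.H P.U,
          Z.IsBraided r P.π ∧ Zesting.FiveTuple.Corresponds P Z T) ∧
    -- the same without requiring that `λ` is symmetric and that `γ` is the restriction of `r⁻¹`
    ((∀ Z : Zesting.ZestingData k P.H P.U, Z.IsAssociative P.π ∧ Z.SatisfiesBZ r P.π →
        ∃! T : Zesting.FiveTuple k Γ P.U,
          T.IsAdmissible P ∧ Zesting.FiveTuple.Corresponds P Z T) ∧
      ∀ T : Zesting.FiveTuple k Γ P.U, T.IsAdmissible P →
        ∃! Z : Zesting.ZestingData k P.H P.U,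
          (Z.IsAssociative P.π ∧ Z.SatisfiesBZ r P.π) ∧
            Zesting.FiveTuple.Corresponds P Z T) := by
  refine ⟨Zesting.Bos.isUniversalGrading_grading hk P.char_deg,
    ⟨fun Z hZ => ?_, fun T hT => ?_⟩, fun Z hZ => ?_, fun T hT => ?_⟩
  · obtain ⟨T, h⟩ := Zesting.FiveTuple.exists_tuple_corresponds Z
    exact ⟨T, ⟨(h.isBraided_iff hk hr).1 hZ, h⟩, fun T' h' => h'.2.tuple_unique h⟩
  · obtain ⟨Z, h⟩ := Zesting.FiveTuple.exists_data_corresponds hk T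
    exact ⟨Z, ⟨(h.isBraided_iff hk hr).2 hT, h⟩, fun Z' h' => h'.2.data_unique hk h⟩
  · obtain ⟨T, h⟩ := Zesting.FiveTuple.exists_tuple_corresponds Z
    exact ⟨T, ⟨(h.isAdmissible_iff hk hr).1 hZ, h⟩, fun T' h' => h'.2.tuple_unique h⟩
  · obtain ⟨Z, h⟩ := Zesting.FiveTuple.exists_data_corresponds hk T
    exact ⟨Z, ⟨(h.isAdmissible_iff hk hr).2 hT, h⟩, fun Z' h' => h'.2.data_unique hk h⟩
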